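/- Let $M$ be a smooth ($C^\infty$, Hausdorff, second countable) manifold of dimension $n$ that is filtered: $TM$ carries smooth subbundles $0=H^0\subseteq H^1\subseteq\dots\subseteq H^N=TM$ of constant rank with $[\Gamma(H^i),\Gamma(H^j)]\subseteq\Gamma(H^{i+j})$ (where $H^i=TM$ for $i\ge N$). Let $d_H=\sum_i i\,\mathrm{rank}(H^i/H^{i-1})$ be its homogeneous dimension, $\mathcal T_HM$ the bundle of osculating groups, with fibre $\mathcal T_HM_x\cong\bigoplus_i H^i_x/H^{i-1}_x$ (in exponential coordinates) and dilations $\delta_s$ acting by $s^i$ in degree $i$, and let $\mathbb T_HM=(M\times M\times\mathbb R^*)\sqcup(\mathcal T_HM\times\{0\})$ be the filtered tangent groupoid with its smooth structure, given on $M\times M\times\mathbb R^*$ by the product structure and near $t=0$ by the exponential charts of local frames $X_1,\dots,X_n$ adapted to the filtration, $(x,v,t)\mapsto(x,\exp(-(\delta_tv)\cdot X).x,t)$ for $t\ne0$ and $(x,v,0)\mapsto(x,\sum_jv_j[X_j(x)],0)$. Its range and source maps to $M\times\mathbb R$ are $r(y,x,t)=(y,t)$, $s(y,x,t)=(x,t)$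 for $t\neq 0$, and $r(x,\xi,0)=s(x,\xi,0)=(x,0)$. For $s>0$ let $\alpha_s(y,x,t)=(y,x,s^{-1}t)$ for $t\neq 0$ and $\alpha_s(x,\xi,0)=(x,\delta_s\xi,0)$. Fix a smooth positive measure $dx$ on $M$, and let $d\lambda_x$ be the induced density (a Haar measure) on $\mathcal T_HM_x$. An $r$-fibered distribution is a continuous $C^\infty(M\times\mathbb R)$-linear map $\mathbb k:C^\infty(\mathbb T_HM)\to C^\infty(M\times\mathbb R)$. Let $\mathbb k\in\boldsymbol\Psi_{\mathrm{vEY}}^{-d_H}(\mathbb T_HM)$, that is, $\mathbb k$ is an $r$-fibered distribution whose support is proper for $r$ and for $s$, and for every $s>0$ $$F_s:=s^{d_H}\alpha_{s*}\mathbb k-\mathbb k$$ is a smooth section of the bundle of $1$-densities on the $r$-fibres whose support is proper for $r$ and for $s$. Then for every $x\in M$ the map $s\mapsto F_s|_{(x,0,0)}$ (the value of the density at the unit $0$ of $\mathcal T_HM_x$, identified with a complex number by means of $d\lambda_x$) is a group homomorphism from $(\mathbb R_+^*,\times)$ to $(\mathbb C,+)$. More precisely, there is a constant $r_x\in\mathbb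 C$ such that for all $s>0$ $$\bigl(s^{d_H}\alpha_{s*}\mathbb k-\mathbb k\bigr)|_{(x,0,0)}=r_x\log(s)\,d\lambda_x .$$ In particular, $\frac1{\log s}\bigl(s^{d_H}\alpha_{s*}\mathbb k-\mathbb k\bigr)|_{(x,0,0)}=r_x\,d\lambda_x$ does not depend on $s\in\mathbb R_+^*\setminus\{1\}$. -/

import Mathlib

open scoped Manifold ContDiff Topology
open MeasureTheory

-- vector spaces are manifolds by `chartedSpaceSelf`; a redundant instance that would hide it
attribute [-instance] TopCat.of.chartedSpace

noncomputable section

namespace FiltMfd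

/-- The model space `ℝⁿ`. -/
abbrev Vec (n : ℕ) : Type := EuclideanSpace ℝ (Fin n)

/-- The Lie derivative `V f` of a real function along a vector field. -/
def lieD {n : ℕ} {M : Type*} [TopologicalSpace M] [ChartedSpace (Vec n) M]
    (V : ∀ y : M, TangentSpace 𝓘(ℝ, Vec n) y) (f : M → ℝ) : M → ℝ :=
  fun y => (mfderiv 𝓘(ℝ, Vec n) 𝓘(ℝ, ℝ) f y (V y) : ℝ)

/-- Smoothness on `U` of a vector field. -/
def SmoothVF {n : ℕ} {M : Type*} [TopologicalSpace M] [ChartedSpace (Vec n) M]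
    [IsManifold 𝓘(ℝ, Vec n) ∞ M] (V : ∀ y : M, TangentSpace 𝓘(ℝ, Vec n) y) (U : Set M) : Prop :=
  ContMDiffOn 𝓘(ℝ, Vec n) 𝓘(ℝ, Vec n).tangent ∞
    (fun y => (⟨y, V y⟩ : TangentBundle 𝓘(ℝ, Vec n) M)) U

/-- `b` is a basis of `T_x M` which is adapted to the increasing family `H i` of subspaces:
for every `i` the space `H i` is spanned by the `b j` with `w j ≤ i`. -/
structure IsAdaptedBasis {n : ℕ} {M : Type*} [TopologicalSpace M] [ChartedSpace (Vec n) M]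
    (w : Fin n → ℕ) (x : M) (H : ℕ → Submodule ℝ (TangentSpace 𝓘(ℝ, Vec n) x))
    (b : Fin n → TangentSpace 𝓘(ℝ, Vec n) x) : Prop where
  linearIndependent : LinearIndependent ℝ b
  span_eq : ∀ i, H i = Submodule.span ℝ (b '' {j | w j ≤ i})

/-- The structure of a filtered manifold on a smooth manifold `M` of dimension `n`: a filtration
`0 = H⁰ ≤ H¹ ≤ ⋯ ≤ Hᴺ = TM` of the tangent bundle by smooth subbundles (of constant rank) with
`[Γ(Hⁱ), Γ(Hʲ)] ⊆ Γ(Hⁱ⁺ʲ)`.  The ranks are recorded by the weights: `rank Hⁱ = #{j | w j ≤ i}`.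
That the `Hⁱ` are nested smooth subbundles of these ranks is the existence of local adapted
frames; in particular `H⁰ = 0` (weights are positive) and `Hⁱ = TM` when `i` is large. -/
structure FilteredManifold (n : ℕ) (M : Type*) [TopologicalSpace M] [ChartedSpace (Vec n) M]
    [IsManifold 𝓘(ℝ, Vec n) ∞ M] where
  /-- the weights -/
  w : Fin n → ℕ
  w_pos : ∀ j, 1 ≤ w j
  /-- the subbundles -/
  H : ℕ → ∀ x : M, Submodule ℝ (TangentSpace 𝓘(ℝ, Vec n) x)
  exists_frame : ∀ x₀ : M, ∃ (U : Set M) (X : Fin n → ∀ x : M, TangentSpace 𝓘(ℝ, Vec n) x),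
    IsOpen U ∧ x₀ ∈ U ∧ (∀ j, SmoothVF (X j) U) ∧
      ∀ x ∈ U, IsAdaptedBasis w x (fun i => H i x) (fun j => X j x)
  bracket_mem : ∀ (i j : ℕ) (U : Set M) (X Y : ∀ x : M, TangentSpace 𝓘(ℝ, Vec n) x),
    IsOpen U → SmoothVF X U → SmoothVF Y U →
    (∀ x ∈ U, X x ∈ H i x) → (∀ x ∈ U, Y x ∈ H j x) →
    ∀ x ∈ U, VectorField.mlieBracket 𝓘(ℝ, Vec n) X Y x ∈ H (i + j) x

section Osculating

variable {n : ℕ} {M : Type*} [TopologicalSpace M] [ChartedSpace (Vec n) M]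
  [IsManifold 𝓘(ℝ, Vec n) ∞ M] (F : FilteredManifold n M)

/-- The homogeneous dimension `d_H = ∑ i · rank (Hⁱ / Hⁱ⁻¹) = ∑ w j`. -/
def FilteredManifold.homDim : ℕ := ∑ j, F.w j

/-- The depth of the filtration: the largest weight. -/
def FilteredManifold.depth : ℕ := Finset.univ.sup F.w

/-- A basis of `T_x M` adapted to the filtration. -/
abbrev FilteredManifold.IsAdapted (x : M) (b : Fin n → TangentSpace 𝓘(ℝ, Vec n) x) : Prop :=
  IsAdaptedBasis F.w x (fun i => F.H i x) b

/-- The fibre over `x` of the bundle of osculating groups: the graded vector space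
`⊕ Hⁱ⁺¹_x / Hⁱ_x` (the product has only finitely many nonzero factors), on which the osculating
group lives in exponential coordinates; the unit of the group is `0`, and its Haar measures are
the Lebesgue measures. -/
abbrev FilteredManifold.Osc (x : M) : Type :=
  ∀ i : ℕ, (F.H (i + 1) x) ⧸ (F.H i x).submoduleOf (F.H (i + 1) x)

/-- The dilations `δ_s` of the osculating group: `s ^ i` on the part of degree `i`. -/
def FilteredManifold.oscDil (s : ℝ) {x : M} (ξ : F.Osc x) : F.Osc x :=
  fun i => s ^ (i + 1) • ξ i

/-- The dilations of `ℝⁿ` with the given weights. -/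
def FilteredManifold.dil (s : ℝ) (v : Vec n) : Vec n :=
  WithLp.toLp 2 (fun j => s ^ (F.w j) * v j)

variable {F}

theorem adapted_sum_mem {x : M} {b : Fin n → TangentSpace 𝓘(ℝ, Vec n) x}
    (hb : F.IsAdapted x b) (v : Vec n) (i : ℕ) :
    ∑ j ∈ Finset.univ.filter (fun j => F.w j = i), v j • b j ∈ F.H i x := by
  refine Submodule.sum_mem _ fun j hj => Submodule.smul_mem _ _ ?_
  rw [show F.H i x = _ from hb.span_eq i]
  exact Submodule.subset_span ⟨j, (Finset.mem_filter.mp hj).2.le, rfl⟩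

/-- The linear coordinates `v ↦ ∑ v_j [b_j]` on the osculating group given by an adapted basis,
where `[b_j]` is the class of `b_j` in the part of degree `w j`. -/
def oscCoord {x : M} {b : Fin n → TangentSpace 𝓘(ℝ, Vec n) x}
    (hb : F.IsAdapted x b) (v : Vec n) : F.Osc x :=
  fun i => Submodule.Quotient.mk
    ⟨∑ j ∈ Finset.univ.filter (fun j => F.w j = i + 1), v j • b j, adapted_sum_mem hb v (i + 1)⟩

theorem oscDil_oscCoord {x : M} {b : Fin n → TangentSpace 𝓘(ℝ, Vec n) x}
    (hb : F.IsAdapted x b) (s : ℝ) (v : Vec n) :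
    F.oscDil s (oscCoord hb v) = oscCoord hb (F.dil s v) := by
  funext i
  simp only [FilteredManifold.oscDil, oscCoord, ← Submodule.Quotient.mk_smul]
  congr 1
  apply Subtype.ext
  simp only [SetLike.val_smul, Finset.smul_sum]
  refine Finset.sum_congr rfl fun j hj => ?_
  simp [FilteredManifold.dil, (Finset.mem_filter.mp hj).2, smul_smul]

theorem dil_dil (s t : ℝ) (v : Vec n) : F.dil s (F.dil t v) = F.dil (s * t) v := by
  ext j
  simp [FilteredManifold.dil, mul_pow, mul_assoc]

variable (F)

/-- The filtered tangent groupoid `M × M × ℝ^* ⊔ T_H M × {0}`, as a set. -/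
inductive TangentGroupoid : Type _
  | pair (y x : M) (t : ℝ) (ht : t ≠ 0) : TangentGroupoid
  | osc (x : M) (ξ : F.Osc x) : TangentGroupoid

variable {F}

namespace TangentGroupoid

/-- The range map, with the parameter `t`. -/
def range : TangentGroupoid F → M × ℝ
  | pair y _ t _ => (y, t)
  | osc x _ => (x, 0)

/-- The source map, with the parameter `t`. -/
def source : TangentGroupoid F → M × ℝ
  | pair _ x t _ => (x, t)
  | osc x _ => (x, 0)

/-- The Debord-Skandalis (zoom) action `α_s` of `s > 0`. -/
def zoom (s : {s : ℝ // 0 < s}) : TangentGroupoid F → TangentGroupoid F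
  | pair y x t ht => pair y x ((s : ℝ)⁻¹ * t) (mul_ne_zero (inv_ne_zero s.2.ne') ht)
  | osc x ξ => osc x (F.oscDil s ξ)

variable (F) in
/-- The inclusion of `M × M × ℝ^*`; the value at `t = 0` is a dummy. -/
def incl (p : M × (M × ℝ)) : TangentGroupoid F :=
  if ht : p.2.2 ≠ 0 then pair p.1 p.2.1 p.2.2 ht else osc p.1 0

end TangentGroupoid

variable (F)

/-- Exponential charts.  `X` is an adapted local frame on `U`, and `(x, v) ↦ (x, E (x, v))` is a
diffeomorphism from an open neighbourhood `Ω` of the zero section `U × {0}` in `U × ℝⁿ` onto an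
open set `W` of `M × M`, where `E` is an exponential map for the frame, up to terms that the
filtration does not see: `τ ↦ E (x, τ v)` has at `τ = 0` the same Taylor expansion as the flow line
`τ ↦ exp (τ v·X).x` of the vector field `v·X = ∑ v_j X_j`, up to the order of the depth of the
filtration.  (The Taylor coefficients of `f (exp (τ v·X).x)` are the `((v·X)^k f)(x) / k!`.)
The time-one flow `E (x, v) = exp (v·X).x` is of this kind.  Terms of order greater than the depth
in `v` have, after the rescaling `δ_t⁻¹ ∘ _ ∘ δ_t`, a positive power of `t` as a factor, so all
these maps define the same smooth structure on the tangent groupoid. -/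
structure ExpChart where
  U : Set M
  X : Fin n → ∀ x : M, TangentSpace 𝓘(ℝ, Vec n) x
  Ω : Set (M × Vec n)
  E : M × Vec n → M
  W : Set (M × M)
  /-- the inverse map -/
  L : M × M → Vec n
  isOpen_U : IsOpen U
  smooth_X : ∀ j, SmoothVF (X j) U
  adapted : ∀ x ∈ U, F.IsAdapted x (fun j => X j x)
  isOpen_Ω : IsOpen Ω
  fst_mem : ∀ p ∈ Ω, p.1 ∈ U
  zero_mem : ∀ x ∈ U, (x, (0 : Vec n)) ∈ Ω
  smooth_E : ContMDiffOn (𝓘(ℝ, Vec n).prod 𝓘(ℝ, Vec n)) 𝓘(ℝ, Vec n) ∞ E Ω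
  isOpen_W : IsOpen W
  smooth_L : ContMDiffOn (𝓘(ℝ, Vec n).prod 𝓘(ℝ, Vec n)) 𝓘(ℝ, Vec n) ∞ L W
  mapsTo : ∀ p ∈ Ω, (p.1, E p) ∈ W
  left_inv : ∀ p ∈ Ω, L (p.1, E p) = p.2
  mapsTo_symm : ∀ q ∈ W, (q.1, L q) ∈ Ω
  right_inv : ∀ q ∈ W, E (q.1, L q) = q.2
  jet_eq : ∀ x ∈ U, ∀ v : Vec n, ∀ f : M → ℝ, ContMDiff 𝓘(ℝ, Vec n) 𝓘(ℝ, ℝ) ∞ f →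
    ∀ k ≤ F.depth, iteratedDeriv k (fun τ : ℝ => f (E (x, τ • v))) 0 =
      ((lieD fun y => ∑ j, v j • X j y)^[k] f) x

variable {F}

/-- The domain in `M × ℝⁿ × ℝ` of the parametrization of the groupoid given by `c`. -/
def ExpChart.dom (c : ExpChart F) : Set (M × (Vec n × ℝ)) :=
  {p | (p.1, -F.dil p.2.2 p.2.1) ∈ c.Ω}

/-- `p.1 ∈ U` for points of the domain. -/
theorem ExpChart.adapted_of_mem (c : ExpChart F) {p : M × (Vec n × ℝ)} (hp : p ∈ c.dom) :
    F.IsAdapted p.1 (fun j => c.X j p.1) := c.adapted _ (c.fst_mem _ hp)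

/-- The parametrization of an open subset of the groupoid given by `c`:
`(x, v, t) ↦ (x, exp (-(δ_t v)·X).x, t)` for `t ≠ 0`, and `(x, v, 0) ↦ (x, ∑ v_j [X_j(x)], 0)`. -/
def ExpChart.param (c : ExpChart F) (p : c.dom) : TangentGroupoid F :=
  if ht : p.1.2.2 ≠ 0 then
    .pair p.1.1 (c.E (p.1.1, -F.dil p.1.2.2 p.1.2.1)) p.1.2.2 ht
  else .osc p.1.1 (oscCoord (c.adapted_of_mem p.2) p.1.2.1)

open Classical in
/-- The function `f` read in the chart `c` (extended by zero outside the domain). -/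
def ExpChart.read (c : ExpChart F) (f : TangentGroupoid F → ℂ) (p : M × (Vec n × ℝ)) : ℂ :=
  if hp : p ∈ c.dom then f (c.param ⟨p, hp⟩) else 0

/-- The manifold topology of the tangent groupoid: a set is open when its preimages in
`M × M × ℝ^*` and in the domains of all exponential charts are open. -/
instance : TopologicalSpace (TangentGroupoid F) :=
  TopologicalSpace.coinduced
      (fun p : {p : M × (M × ℝ) // p.2.2 ≠ 0} => TangentGroupoid.incl F p.1) inferInstance ⊔
    ⨆ c : ExpChart F, TopologicalSpace.coinduced c.param inferInstance

/-- Smooth functions on the tangent groupoid: smooth on `M × M × ℝ^*` and in every exponential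
chart. -/
structure IsSmooth (f : TangentGroupoid F → ℂ) : Prop where
  pair : ContMDiffOn (𝓘(ℝ, Vec n).prod (𝓘(ℝ, Vec n).prod 𝓘(ℝ, ℝ))) 𝓘(ℝ, ℂ) ∞
    (fun p : M × (M × ℝ) => f (TangentGroupoid.incl F p)) {p | p.2.2 ≠ 0}
  chart : ∀ c : ExpChart F, ContMDiffOn (𝓘(ℝ, Vec n).prod (𝓘(ℝ, Vec n).prod 𝓘(ℝ, ℝ)))
    𝓘(ℝ, ℂ) ∞ (c.read f) c.dom

theorem contMDiffOn_mul_aux {E' H' Z : Type*} [NormedAddCommGroup E'] [NormedSpace ℝ E']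
    [TopologicalSpace H'] {I : ModelWithCorners ℝ E' H'} [TopologicalSpace Z] [ChartedSpace H' Z]
    {f g : Z → ℂ} {s : Set Z} (hf : ContMDiffOn I 𝓘(ℝ, ℂ) ∞ f s)
    (hg : ContMDiffOn I 𝓘(ℝ, ℂ) ∞ g s) : ContMDiffOn I 𝓘(ℝ, ℂ) ∞ (fun z => f z * g z) s := by
  have h : ContDiff ℝ ∞ (fun p : ℂ × ℂ => p.1 * p.2) := contDiff_mul
  exact h.contMDiff.comp_contMDiffOn (hf.prodMk_space hg)

theorem ExpChart.read_of_mem (c : ExpChart F) (f : TangentGroupoid F → ℂ)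
    {p : M × (Vec n × ℝ)} (hp : p ∈ c.dom) : c.read f p = f (c.param ⟨p, hp⟩) := by
  simp [ExpChart.read, hp]

variable (F) in
/-- The algebra `C^∞(T_H M)` of complex smooth functions on the tangent groupoid. -/
def smoothFun : Subalgebra ℂ (TangentGroupoid F → ℂ) where
  carrier := {f | IsSmooth f}
  mul_mem' := by
    rintro f g hf hg
    refine ⟨contMDiffOn_mul_aux hf.pair hg.pair, fun c => ?_⟩
    refine (contMDiffOn_mul_aux (hf.chart c) (hg.chart c)).congr fun p hp => ?_
    simp [c.read_of_mem _ hp]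
  add_mem' := by
    rintro f g hf hg
    refine ⟨hf.pair.add hg.pair, fun c => ?_⟩
    refine ((hf.chart c).add (hg.chart c)).congr fun p hp => ?_
    simp [c.read_of_mem _ hp]
  algebraMap_mem' := by
    intro a
    refine ⟨contMDiffOn_const, fun c => ?_⟩
    refine (contMDiffOn_const (c := a)).congr fun p hp => ?_
    simp [c.read_of_mem _ hp]

variable (n M) in
/-- The algebra `C^∞(M × ℝ)` of complex smooth functions. -/
def baseFun : Subalgebra ℂ (M × ℝ → ℂ) where
  carrier := {f | ContMDiff (𝓘(ℝ, Vec n).prod 𝓘(ℝ, ℝ)) 𝓘(ℝ, ℂ) ∞ f}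
  mul_mem' := by
    rintro f g hf hg
    have := contMDiffOn_mul_aux (contMDiffOn_univ.mpr hf) (contMDiffOn_univ.mpr hg)
    exact contMDiffOn_univ.mp this
  add_mem' := fun hf hg => ContMDiff.add hf hg
  algebraMap_mem' := fun _ => contMDiff_const

theorem ExpChart.range_param (c : ExpChart F) (p : c.dom) :
    (c.param p).range = (p.1.1, p.1.2.2) := by
  unfold ExpChart.param
  split_ifs with h
  · rfl
  · push Not at h
    simp [TangentGroupoid.range, h]

variable (F) in
/-- The pullback `r^* : C^∞(M × ℝ) → C^∞(T_H M)`. -/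
def rangePullback (φ : baseFun n M) : smoothFun F :=
  ⟨fun γ => φ.1 γ.range, by
    have hφ : ContMDiff (𝓘(ℝ, Vec n).prod 𝓘(ℝ, ℝ)) 𝓘(ℝ, ℂ) ∞ φ.1 := φ.2
    constructor
    · refine (hφ.comp_contMDiffOn (s := {p : M × (M × ℝ) | p.2.2 ≠ 0})
        (contMDiffOn_fst.prodMk (contMDiff_snd.comp contMDiff_snd).contMDiffOn)).congr ?_
      intro p hp
      have hp' : p.2.2 ≠ 0 := hp
      simp [TangentGroupoid.incl, hp', TangentGroupoid.range]
    · intro c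
      refine (hφ.comp_contMDiffOn (s := c.dom)
        (contMDiffOn_fst.prodMk (contMDiff_snd.comp contMDiff_snd).contMDiffOn)).congr ?_
      intro p hp
      rw [c.read_of_mem _ hp, c.range_param]
      rfl⟩

/-- The domain of a chart is invariant under `(x, v, t) ↦ (x, δ_s v, s⁻¹ t)`. -/
theorem ExpChart.zoom_mem_dom (c : ExpChart F) (s : {s : ℝ // 0 < s}) {p : M × (Vec n × ℝ)}
    (hp : p ∈ c.dom) : (p.1, F.dil s p.2.1, (s : ℝ)⁻¹ * p.2.2) ∈ c.dom := by
  have hs : (s : ℝ) ≠ 0 := s.2.ne'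
  have : (s : ℝ)⁻¹ * p.2.2 * s = p.2.2 := by field_simp
  simpa [ExpChart.dom, dil_dil, this] using hp

/-- In a chart, the zoom action is `(x, v, t) ↦ (x, δ_s v, s⁻¹ t)`. -/
theorem ExpChart.zoom_param (c : ExpChart F) (s : {s : ℝ // 0 < s}) {p : M × (Vec n × ℝ)}
    (hp : p ∈ c.dom) :
    (c.param ⟨p, hp⟩).zoom s = c.param ⟨_, c.zoom_mem_dom s hp⟩ := by
  have hs : (s : ℝ) ≠ 0 := s.2.ne'
  have h1 : (s : ℝ)⁻¹ * p.2.2 * s = p.2.2 := by field_simp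
  by_cases ht : p.2.2 = 0
  · simp [ExpChart.param, ht, TangentGroupoid.zoom, oscDil_oscCoord]
  · simp [ExpChart.param, ht, hs, TangentGroupoid.zoom, dil_dil, h1]

/-- The pullback `f ↦ f ∘ α_s` on `C^∞(T_H M)`. -/
def zoomPullback (s : {s : ℝ // 0 < s}) (f : smoothFun F) : smoothFun F :=
  ⟨fun γ => f.1 (γ.zoom s), by
    have hf : IsSmooth f.1 := f.2
    have hs : (s : ℝ) ≠ 0 := s.2.ne'
    have hmul : ContDiff ℝ ∞ (fun t : ℝ => (s : ℝ)⁻¹ * t) := contDiff_const.mul contDiff_id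
    have hdil : ContDiff ℝ ∞ (fun v : Vec n => F.dil s v) := by
      rw [contDiff_euclidean]
      intro j
      have : ContDiff ℝ ∞ (fun v : Vec n => v j) := contDiff_euclidean.mp contDiff_id j
      simpa [FilteredManifold.dil] using contDiff_const.mul this
    constructor
    · have h : ContMDiff (𝓘(ℝ, Vec n).prod (𝓘(ℝ, Vec n).prod 𝓘(ℝ, ℝ)))
          (𝓘(ℝ, Vec n).prod (𝓘(ℝ, Vec n).prod 𝓘(ℝ, ℝ))) ∞
          (fun p : M × (M × ℝ) => (p.1, p.2.1, (s : ℝ)⁻¹ * p.2.2)) :=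
        contMDiff_fst.prodMk ((contMDiff_fst.comp contMDiff_snd).prodMk
          (hmul.contMDiff.comp (contMDiff_snd.comp contMDiff_snd)))
      refine (hf.pair.comp h.contMDiffOn (s := {p : M × (M × ℝ) | p.2.2 ≠ 0})
        fun p hp => ?_).congr fun p hp => ?_
      · exact mul_ne_zero (inv_ne_zero hs) hp
      · have hp' : p.2.2 ≠ 0 := hp
        simp [TangentGroupoid.incl, hp', hs, TangentGroupoid.zoom]
    · intro c
      have h : ContMDiff (𝓘(ℝ, Vec n).prod (𝓘(ℝ, Vec n).prod 𝓘(ℝ, ℝ)))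
          (𝓘(ℝ, Vec n).prod (𝓘(ℝ, Vec n).prod 𝓘(ℝ, ℝ))) ∞
          (fun p : M × (Vec n × ℝ) => (p.1, F.dil s p.2.1, (s : ℝ)⁻¹ * p.2.2)) :=
        contMDiff_fst.prodMk ((hdil.contMDiff.comp (contMDiff_fst.comp contMDiff_snd)).prodMk
          (hmul.contMDiff.comp (contMDiff_snd.comp contMDiff_snd)))
      refine ((hf.chart c).comp h.contMDiffOn (s := c.dom)
        fun p hp => c.zoom_mem_dom s hp).congr fun p hp => ?_
      rw [c.read_of_mem _ hp, c.zoom_param s hp, Function.comp_apply,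
        c.read_of_mem _ (c.zoom_mem_dom s hp)]⟩

end Osculating

/-- The `C^∞` topology on functions on an open subset `O` of a manifold without boundary: uniform
convergence on compact sets of all derivatives in charts. -/
abbrev cInfTopology {E' H' Z : Type*} [NormedAddCommGroup E'] [NormedSpace ℝ E']
    [TopologicalSpace H'] (I : ModelWithCorners ℝ E' H') [TopologicalSpace Z] [ChartedSpace H' Z]
    (O : Set Z) : TopologicalSpace (Z → ℂ) :=
  ⨅ (z : Z) (m : ℕ), TopologicalSpace.induced
    (fun f => UniformOnFun.ofFun
      {K : Set E' | IsCompact K ∧ K ⊆ (extChartAt I z).target ∩ (extChartAt I z).symm ⁻¹' O}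
      (iteratedFDeriv ℝ m (f ∘ (extChartAt I z).symm))) inferInstance

section Distributions

variable {n : ℕ} {M : Type*} [TopologicalSpace M] [ChartedSpace (Vec n) M]
  [IsManifold 𝓘(ℝ, Vec n) ∞ M] {F : FilteredManifold n M}

variable (F) in
/-- The `C^∞` topology on `C^∞(T_H M)`. -/
abbrev smoothFunTopology : TopologicalSpace (smoothFun F) :=
  TopologicalSpace.induced (fun f p => f.1 (TangentGroupoid.incl F p))
      (cInfTopology (𝓘(ℝ, Vec n).prod (𝓘(ℝ, Vec n).prod 𝓘(ℝ, ℝ)))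
        {p : M × (M × ℝ) | p.2.2 ≠ 0}) ⊓
    ⨅ c : ExpChart F, TopologicalSpace.induced (fun f => c.read f.1)
      (cInfTopology (𝓘(ℝ, Vec n).prod (𝓘(ℝ, Vec n).prod 𝓘(ℝ, ℝ))) c.dom)

variable (n M) in
/-- The `C^∞` topology on `C^∞(M × ℝ)`. -/
abbrev baseFunTopology : TopologicalSpace (baseFun n M) :=
  TopologicalSpace.induced Subtype.val
    (cInfTopology (𝓘(ℝ, Vec n).prod 𝓘(ℝ, ℝ)) (Set.univ : Set (M × ℝ)))

variable (F) in
/-- An `r`-fibered distribution: a continuous `C^∞(M × ℝ)`-linear map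
`C^∞(T_H M) → C^∞(M × ℝ)`. -/
structure RFiberedDistribution where
  toLinearMap : smoothFun F →ₗ[ℂ] baseFun n M
  map_rangePullback_mul : ∀ (φ : baseFun n M) (f : smoothFun F),
    toLinearMap (rangePullback F φ * f) = φ * toLinearMap f
  continuous : Continuous[smoothFunTopology F, baseFunTopology n M] toLinearMap

/-- A subset of the groupoid is proper when the range and the source maps are proper on it
(for closed sets). -/
def IsProperSet (S : Set (TangentGroupoid F)) : Prop :=
  ∀ K : Set (M × ℝ), IsCompact K →
    IsCompact (S ∩ TangentGroupoid.range ⁻¹' K) ∧ IsCompact (S ∩ TangentGroupoid.source ⁻¹' K)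

namespace RFiberedDistribution

/-- The support of an `r`-fibered distribution. -/
def supp (k : RFiberedDistribution F) : Set (TangentGroupoid F) :=
  {γ | ∀ V : Set (TangentGroupoid F), IsOpen V → γ ∈ V →
    ∃ f : smoothFun F, tsupport f.1 ⊆ V ∧ k.toLinearMap f ≠ 0}

/-- The pushforward `α_{s*} k`, evaluated on a function `f`.  As `α_s` covers the diffeomorphism
`(x, t) ↦ (x, s⁻¹ t)` of `M × ℝ`, the value at `(x, t)` is that of `k (f ∘ α_s)` at `(x, s t)`. -/
def pushforward (k : RFiberedDistribution F) (s : {s : ℝ // 0 < s}) (f : smoothFun F) :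
    M × ℝ → ℂ :=
  fun p => (k.toLinearMap (zoomPullback s f)).1 (p.1, s * p.2)

end RFiberedDistribution

end Distributions

section Densities

variable {n : ℕ} {M : Type*} [TopologicalSpace M] [ChartedSpace (Vec n) M]
  [IsManifold 𝓘(ℝ, Vec n) ∞ M] [MeasurableSpace M] {F : FilteredManifold n M}

variable (n M) in
/-- A smooth (positive) measure `dx` on `M`: one with a smooth positive density with respect to
Lebesgue measure in charts. -/
structure SmoothMeasure where
  measure : Measure M
  /-- the density in the chart at a point -/
  density : M → Vec n → ℝ
  smooth : ∀ x, ContDiffOn ℝ ∞ (density x) (chartAt (Vec n) x).target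
  pos : ∀ x, ∀ u ∈ (chartAt (Vec n) x).target, 0 < density x u
  map_eq : ∀ x, (measure.restrict (chartAt (Vec n) x).source).map (chartAt (Vec n) x) =
    ((volume : Measure (Vec n)).restrict (chartAt (Vec n) x).target).withDensity
      (fun u => ENNReal.ofReal (density x u))

/-- The value of the density `dx` on a basis `b` of `T_x M` (where `T_x M` is identified with `ℝⁿ`
by the chart at `x`).  For an adapted basis `b`, this is also the value on the basis `[b_j]` of the
canonically induced density `dλ_x` on the osculating group at `x`: in the coordinates
`v ↦ ∑ v_j [b_j]`, the Haar measure `dλ_x` is `μ.onBasis x b` times Lebesgue measure. -/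
def SmoothMeasure.onBasis (μ : SmoothMeasure n M) (x : M)
    (b : Fin n → TangentSpace 𝓘(ℝ, Vec n) x) : ℝ :=
  μ.density x (chartAt (Vec n) x x) *
    |(Matrix.of fun i j => (show Vec n from b j) i).det|

/-- The bundle `Ω_r` of densities on the `r`-fibres of the groupoid has a canonical smooth positive
section: `|t|^{-d_H} dx'` on the fibre `{(x, x', t)}` over `(x, t)` for `t ≠ 0`, and `dλ_x` on the
fibre `{(x, ξ, 0)}` over `(x, 0)`.  So its smooth sections are the products of smooth functions `g`
with this section.  `IsDensityOf μ T g` says that the map `T` (defined on `C^∞(T_H M)`, with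
values functions on `M × ℝ`) is integration along the `r`-fibres against the section given by
`g`. -/
structure IsDensityOf (μ : SmoothMeasure n M) (T : smoothFun F → M × ℝ → ℂ) (g : smoothFun F) :
    Prop where
  pair : ∀ (f : smoothFun F) (x : M) (t : ℝ) (ht : t ≠ 0), T f (x, t) =
    ∫ x', f.1 (.pair x x' t ht) * g.1 (.pair x x' t ht) * ((|t| ^ F.homDim)⁻¹ : ℝ) ∂μ.measure
  osc : ∀ (f : smoothFun F) (x : M) (b : Fin n → TangentSpace 𝓘(ℝ, Vec n) x)
    (hb : F.IsAdapted x b), T f (x, 0) =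
    ∫ v : Vec n, f.1 (.osc x (oscCoord hb v)) * g.1 (.osc x (oscCoord hb v)) * (μ.onBasis x b : ℝ)

/-- `g` is (the coefficient of) the cocycle at `s`, `s^{-m} α_{s*} k - k`, a properly supported
smooth section of `Ω_r`. -/
structure IsCocycle (μ : SmoothMeasure n M) (k : RFiberedDistribution F) (m : ℤ)
    (s : {s : ℝ // 0 < s}) (g : smoothFun F) : Prop where
  proper : IsProperSet (tsupport g.1)
  density : IsDensityOf μ
    (fun f p => ((s : ℝ) : ℂ) ^ (-m) * k.pushforward s f p - (k.toLinearMap f).1 p) g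

/-- Membership in `Ψ_vEY^m(T_H M)`: the `r`-fibered distribution `k` is properly supported and
essentially homogeneous of order `m` for the zoom action. -/
structure IsEssHomogeneous (μ : SmoothMeasure n M) (k : RFiberedDistribution F) (m : ℤ) :
    Prop where
  proper : IsProperSet k.supp
  exists_cocycle : ∀ s : {s : ℝ // 0 < s}, ∃ g : smoothFun F, IsCocycle μ k m s g

end Densities

end FiltMfd

end

/-! Write `d` for the homogeneous dimension and `F_s` for the coefficient of `s^d α_{s*}k − k`.
Telescoping gives `(st)^d α_{st*}k − k = s^d α_{s*}(t^d α_{t*}k − k) + (s^d α_{s*}k − k)`. On the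
fibre over `(x, 0)` the factor `s^d` cancels the Jacobian of `δ_s`, so that `F_{st} = F_t ∘ δ_{1/s}
+ F_s` there (`IsCocycle.cocycle_identity`). Dilations fix the unit, hence `s ↦ F_s(x, 0, 0)` is
additive (`IsCocycle.map_mul`).

Additivity yields a logarithm only together with some regularity in `s`, whereas each `F_s` is given
separately. The regularity comes from the continuity of `k`: since `s ↦ f ∘ α_s` is continuous into
`C^∞`, the pairing of `F_s` with a fixed `f` depends continuously on `s`
(`RFiberedDistribution.continuous_apply_zoomPullback`). Zooming one test function towards a Dirac
mass at the unit exhibits the value of `F_s` there as a pointwise limit of continuous functions of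
`s`, hence as a measurable one (`measurable_cocycle_unit`). A measurable homomorphism `ℝ → ℂ` is
linear (`exists_eq_mul_log`).

No bump functions on the groupoid are built. The test functions are made from the cocycles
themselves: a smooth function that annihilates its own conjugate on the fibre vanishes there, and
`|F_{s₀}|²` serves as approximate Dirac mass.

All this uses that `F_s` is continuous with compact support on the fibre. Smoothness near `t = 0` is
read in exponential charts, so each point must lie in one (`exists_expChart`). The chart is built
from the Taylor polynomial of the flow, which has the required jet by construction, and the inverse
function theorem. -/

noncomputable section

namespace FiltMfd

/-! ### Taylor polynomials of flows in a vector space. -/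

section Jets

open Set Filter

variable {V E G : Type*} [NormedAddCommGroup V] [NormedSpace ℝ V] [NormedAddCommGroup E]
  [NormedSpace ℝ E] [NormedAddCommGroup G] [NormedSpace ℝ G]

/-- The derivative of `g` along the vector field `u ↦ a u v`. -/
def dirD (a : E → V →L[ℝ] E) (v : V) (g : E → G) : E → G :=
  fun u => fderiv ℝ g u (a u v)

theorem dirD_iterate_smul (a : E → V →L[ℝ] E) (τ : ℝ) (v : V) (g : E → G) (k : ℕ) :
    (dirD a (τ • v))^[k] g = τ ^ k • (dirD a v)^[k] g := by
  induction k with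
  | zero => simp
  | succ k ih =>
    rw [Function.iterate_succ_apply', Function.iterate_succ_apply', ih]
    funext u
    simp only [dirD, Pi.smul_apply, map_smul]
    rw [fderiv_const_smul_field]
    simp [smul_smul, pow_succ, mul_comm]

theorem contDiffOn_dirD_iterate {a : E → V →L[ℝ] E} {A : Set E} (hA : IsOpen A)
    (ha : ContDiffOn ℝ ∞ a A) {g : E → G} (hg : ContDiffOn ℝ ∞ g A) (k : ℕ) :
    ContDiffOn ℝ ∞ (fun p : E × V => (dirD a p.2)^[k] g p.1) (A ×ˢ univ) := by
  have hO : IsOpen (A ×ˢ (univ : Set V)) := hA.prod isOpen_univ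
  induction k with
  | zero => exact hg.comp contDiffOn_fst fun p hp => hp.1
  | succ k ih =>
    -- The parameter `v` is kept fixed by differentiating the joint function in the direction `(a u
    -- v, 0)`; this is why the induction runs on joint smoothness in `(u, v)`.
    have h1 : ContDiffOn ℝ ∞ (fun p : E × V => fderiv ℝ
        (fun p : E × V => (dirD a p.2)^[k] g p.1) p (a p.1 p.2, 0)) (A ×ˢ univ) := by
      refine (ih.fderiv_of_isOpen hO le_rfl).clm_apply (ContDiffOn.prodMk ?_ contDiffOn_const)
      exact (ha.comp contDiffOn_fst fun p hp => hp.1).clm_apply contDiffOn_snd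
    refine h1.congr fun p hp => ?_
    rw [Function.iterate_succ_apply', dirD]
    have hd : HasFDerivAt (fun p : E × V => (dirD a p.2)^[k] g p.1) _ (p.1, p.2) :=
      ((ih.contDiffAt (hO.mem_nhds hp)).differentiableAt (by simp)).hasFDerivAt
    have := (HasFDerivAt.comp (f := fun u : E => (u, p.2)) p.1 hd
      (hasFDerivAt_prodMk_left p.1 p.2)).fderiv
    simp only [Function.comp_def] at this
    rw [this]
    simp

/-- Along an integral curve, `d/dτ` acts as the derivation `dirD a v`. The equality holds near `0`,
not only at `0`, so that it can be differentiated again. -/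
theorem iteratedDeriv_comp_eq_dirD {a : E → V →L[ℝ] E} {A : Set E} (hA : IsOpen A)
    (ha : ContDiffOn ℝ ∞ a A) {g : E → G} (hg : ContDiffOn ℝ ∞ g A) {v : V} {γ : ℝ → E}
    (hγ : ∀ᶠ τ in 𝓝 (0 : ℝ), HasDerivAt γ (a (γ τ) v) τ) (h0 : γ 0 ∈ A) (k : ℕ) :
    iteratedDeriv k (fun τ => g (γ τ)) =ᶠ[𝓝 0] fun τ => (dirD a v)^[k] g (γ τ) := by
  have hmem : ∀ᶠ τ in 𝓝 (0 : ℝ), γ τ ∈ A :=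
    hγ.self_of_nhds.continuousAt.eventually_mem (hA.mem_nhds h0)
  induction k with
  | zero => simp
  | succ k ih =>
    rw [iteratedDeriv_succ]
    filter_upwards [ih.deriv, hγ, hmem] with τ h1 h2 h3
    rw [h1, Function.iterate_succ_apply', dirD]
    have hs : ContDiffOn ℝ ∞ ((dirD a v)^[k] g) A :=
      (contDiffOn_dirD_iterate hA ha hg k).comp (contDiff_prodMk_left v).contDiffOn
        fun u hu => ⟨hu, mem_univ _⟩
    have hd := ((hs.contDiffAt (hA.mem_nhds h3)).differentiableAt (by simp)).hasFDerivAt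
    exact (hd.comp_hasDerivAt τ h2).deriv

/-- By the Faà di Bruno formula the `k`-th derivative of a composite involves only derivatives of
the inner curve of order at most `k`. -/
theorem iteratedDeriv_comp_congr {g : E → G} {c₁ c₂ : ℝ → E} {τ : ℝ} {N : ℕ}
    (hg : ContDiffAt ℝ ∞ g (c₁ τ)) (h₁ : ContDiffAt ℝ ∞ c₁ τ) (h₂ : ContDiffAt ℝ ∞ c₂ τ)
    (h : ∀ k ≤ N, iteratedDeriv k c₁ τ = iteratedDeriv k c₂ τ) {k : ℕ} (hk : k ≤ N) :
    iteratedDeriv k (g ∘ c₁) τ = iteratedDeriv k (g ∘ c₂) τ := by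
  have h0 : c₁ τ = c₂ τ := by simpa using h 0 (Nat.zero_le _)
  have key : ∀ j ≤ N, iteratedFDeriv ℝ j c₁ τ = iteratedFDeriv ℝ j c₂ τ := by
    intro j hj
    rw [iteratedFDeriv_eq_equiv_comp, iteratedFDeriv_eq_equiv_comp, Function.comp_apply,
      Function.comp_apply, h j hj]
  have hk' : (k : ℕ∞ω) ≤ ∞ := by exact_mod_cast le_top
  rw [iteratedDeriv_eq_iteratedFDeriv, iteratedDeriv_eq_iteratedFDeriv,
    iteratedFDeriv_comp hg h₁ hk', iteratedFDeriv_comp (h0 ▸ hg) h₂ hk', h0]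
  congr 1
  refine Finset.sum_congr rfl fun c _ => ?_
  refine ContinuousMultilinearMap.ext fun m => ?_
  simp only [FormalMultilinearSeries.compAlongOrderedFinpartition_apply]
  congr 1
  funext i
  simp only [OrderedFinpartition.applyOrderedFinpartition_apply, ftaylorSeries]
  rw [key _ ((c.partSize_le i).trans hk)]

/-- Picard–Lindelöf provides a differentiable solution; smoothness of the field then bootstraps its
regularity on a small closed interval. -/
theorem exists_smooth_integralCurve [CompleteSpace E] {f : E → E} {A : Set E} (hA : IsOpen A)
    (hf : ContDiffOn ℝ ∞ f A) {u : E} (hu : u ∈ A) :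
    ∃ γ : ℝ → E, γ 0 = u ∧ ContDiffAt ℝ ∞ γ 0 ∧ ∀ᶠ τ in 𝓝 (0 : ℝ), HasDerivAt γ (f (γ τ)) τ := by
  have h1 : ContDiffAt ℝ 1 f u := (hf.contDiffAt (hA.mem_nhds hu)).of_le (by simp)
  obtain ⟨γ, h0, ε, hε, h⟩ := h1.exists_forall_mem_closedBall_exists_eq_forall_mem_Ioo_hasDerivAt₀ 0
  have hc : ContinuousAt γ 0 := (h 0 (by simp [hε])).continuousAt
  have hmem : ∀ᶠ τ in 𝓝 (0 : ℝ), γ τ ∈ A := hc.eventually_mem (hA.mem_nhds (h0 ▸ hu))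
  have hIoo : ∀ᶠ τ in 𝓝 (0 : ℝ), τ ∈ Ioo (0 - ε) (0 + ε) := Ioo_mem_nhds (by simp [hε]) (by simp [hε])
  refine ⟨γ, h0, ?_, hIoo.mono h⟩
  obtain ⟨δ, hδ, hB⟩ := Metric.eventually_nhds_iff_ball.mp (hIoo.and hmem)
  have hI : Icc (-(δ / 2)) (δ / 2) ⊆ Metric.ball (0 : ℝ) δ := fun τ hτ => by
    rw [mem_ball_zero_iff, Real.norm_eq_abs, abs_lt]
    constructor <;> linarith [hτ.1, hτ.2]
  have := ODE.contDiffOn_enat_Icc_of_hasDerivWithinAt (n := ⊤) (f := fun _ => f) (u := A)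
    (tmin := -(δ / 2)) (tmax := δ / 2) (α := γ) (hf.comp contDiffOn_snd fun p hp => hp.2)
    (fun t ht => (h t (hB t (hI ht)).1).hasDerivWithinAt) (fun t ht => (hB t (hI ht)).2)
  exact this.contDiffAt (Icc_mem_nhds (by linarith) (by linarith))

/-- The Taylor polynomial in `v` of order `N` of the time-one flow of the field `u ↦ a u v`. -/
def taylorFlow (a : E → V →L[ℝ] E) (N : ℕ) (p : E × V) : E :=
  ∑ k ∈ Finset.range (N + 1), (k.factorial : ℝ)⁻¹ • (dirD a p.2)^[k] (fun u => u) p.1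

theorem contDiffOn_taylorFlow {a : E → V →L[ℝ] E} {A : Set E} (hA : IsOpen A)
    (ha : ContDiffOn ℝ ∞ a A) (N : ℕ) : ContDiffOn ℝ ∞ (taylorFlow a N) (A ×ˢ univ) :=
  ContDiffOn.sum fun k _ => (contDiffOn_dirD_iterate hA ha contDiffOn_id k).const_smul _

theorem taylorFlow_smul (a : E → V →L[ℝ] E) (N : ℕ) (u : E) (v : V) (τ : ℝ) :
    taylorFlow a N (u, τ • v) = ∑ k ∈ Finset.range (N + 1),
      τ ^ k • (k.factorial : ℝ)⁻¹ • (dirD a v)^[k] (fun u => u) u := by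
  refine Finset.sum_congr rfl fun k _ => ?_
  rw [dirD_iterate_smul, Pi.smul_apply, smul_comm]

theorem taylorFlow_zero (a : E → V →L[ℝ] E) (N : ℕ) (u : E) : taylorFlow a N (u, 0) = u := by
  have := taylorFlow_smul a N u 0 0
  rw [zero_smul, Finset.sum_eq_single 0] at this
  · simpa using this
  · intro k _ hk
    simp [hk]
  · simp

theorem contDiff_taylorFlow_smul (a : E → V →L[ℝ] E) (N : ℕ) (u : E) (v : V) :
    ContDiff ℝ ∞ (fun τ : ℝ => taylorFlow a N (u, τ • v)) := by
  simp only [taylorFlow_smul]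
  fun_prop

theorem iteratedDeriv_taylorFlow_smul (a : E → V →L[ℝ] E) {N k : ℕ} (hk : k ≤ N) (u : E) (v : V) :
    iteratedDeriv k (fun τ : ℝ => taylorFlow a N (u, τ • v)) 0 =
      (dirD a v)^[k] (fun u => u) u := by
  simp only [taylorFlow_smul]
  have hpow : ∀ i : ℕ, ContDiff ℝ k fun τ : ℝ => τ ^ i := fun i => by fun_prop
  rw [iteratedDeriv_fun_sum (f := fun i τ => τ ^ i • (i.factorial : ℝ)⁻¹ •
    (dirD a v)^[i] (fun u => u) u) (fun i _ => ((hpow i).smul contDiff_const).contDiffAt),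
    Finset.sum_eq_single k]
  · rw [iteratedDeriv_smul_const (hpow k).contDiffAt, iteratedDeriv_fun_pow_zero, if_pos rfl,
      smul_smul, mul_inv_cancel₀ (by positivity), one_smul]
  · intro i _ hi
    rw [iteratedDeriv_smul_const (hpow i).contDiffAt, iteratedDeriv_fun_pow_zero, if_neg hi.symm,
      Nat.cast_zero, zero_smul]
  · intro h
    simp at h; omega

/-- The curve `τ ↦ taylorFlow a N (u, τ v)` has the jet of order `N` of the integral curve. -/
theorem iteratedDeriv_comp_taylorFlow [CompleteSpace E] {a : E → V →L[ℝ] E} {A : Set E}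
    (hA : IsOpen A) (ha : ContDiffOn ℝ ∞ a A) {g : E → G} (hg : ContDiffOn ℝ ∞ g A) {u : E}
    (hu : u ∈ A) (v : V) {N k : ℕ} (hk : k ≤ N) :
    iteratedDeriv k (fun τ : ℝ => g (taylorFlow a N (u, τ • v))) 0 = (dirD a v)^[k] g u := by
  obtain ⟨γ, h0, hγ, hd⟩ := exists_smooth_integralCurve hA
    (ha.clm_apply (contDiffOn_const (c := v))) hu
  have hz : taylorFlow a N (u, (0 : ℝ) • v) = u := by rw [zero_smul, taylorFlow_zero]
  -- The polynomial curve is compared with a true integral curve. Their `N`-jets agree by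
  -- `iteratedDeriv_comp_eq_dirD` for the identity function, and then the jets of their images under
  -- `g` agree as well.
  have := iteratedDeriv_comp_congr (g := g) (c₁ := fun τ : ℝ => taylorFlow a N (u, τ • v))
    (c₂ := γ) (τ := 0) (N := N) (by rw [hz]; exact hg.contDiffAt (hA.mem_nhds hu))
    (contDiff_taylorFlow_smul a N u v).contDiffAt hγ (fun j hj => ?_) hk
  · rw [Function.comp_def, Function.comp_def] at this
    rw [this, (iteratedDeriv_comp_eq_dirD hA ha hg hd (h0 ▸ hu) k).eq_of_nhds, h0]
  · rw [iteratedDeriv_taylorFlow_smul a hj,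
      (iteratedDeriv_comp_eq_dirD hA ha (g := fun u => u) contDiffOn_id hd (h0 ▸ hu) j).eq_of_nhds,
      h0]

/-- The term of order one in `v` is `a u v`. For `N = 0` it is missing, and the formula survives
only because `V` is then trivial. -/
theorem hasFDerivAt_taylorFlow_zero {a : E → V →L[ℝ] E} {A : Set E}
    (hA : IsOpen A) (ha : ContDiffOn ℝ ∞ a A) {u : E} (hu : u ∈ A) {N : ℕ}
    (hN : N = 0 → Subsingleton V) :
    HasFDerivAt (taylorFlow a N)
      (ContinuousLinearMap.fst ℝ E V + (a u).comp (ContinuousLinearMap.snd ℝ E V)) (u, 0) := by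
  have hd := (((contDiffOn_taylorFlow hA ha N).contDiffAt ((hA.prod isOpen_univ).mem_nhds
    (show (u, (0 : V)) ∈ A ×ˢ univ from ⟨hu, mem_univ _⟩))).differentiableAt (by simp)).hasFDerivAt
  suffices h : ContinuousLinearMap.fst ℝ E V + (a u).comp (ContinuousLinearMap.snd ℝ E V) =
      fderiv ℝ (taylorFlow a N) (u, 0) by
    rw [h]
    exact hd
  refine ContinuousLinearMap.prod_ext ?_ ?_ <;> ext1 d
  · have h1 := (HasFDerivAt.comp (f := fun u : E => (u, (0 : V))) u hd
      (hasFDerivAt_prodMk_left u 0)).congr_of_eventuallyEq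
      (f₁ := fun u => u) (Eventually.of_forall fun y => by simp [taylorFlow_zero])
    have h2 := congrArg (fun l : E →L[ℝ] E => l d) (h1.unique (hasFDerivAt_id u))
    simpa using h2.symm
  · have hl : HasDerivAt (fun τ : ℝ => ((u, τ • d) : E × V)) (0, d) 0 := by
      have h2 : HasDerivAt (fun τ : ℝ => τ • d) ((1 : ℝ) • d) 0 :=
        (hasDerivAt_id (0 : ℝ)).smul_const d
      rw [one_smul] at h2
      exact (hasDerivAt_const (0 : ℝ) u).prodMk h2
    have hd' : HasFDerivAt (taylorFlow a N) (fderiv ℝ (taylorFlow a N) (u, 0))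
      ((fun τ : ℝ => ((u, τ • d) : E × V)) 0) := by simpa using hd
    have h1 := (hd'.comp_hasDerivAt (0 : ℝ) hl).deriv
    rw [ContinuousLinearMap.comp_apply, ContinuousLinearMap.comp_apply,
      ContinuousLinearMap.inr_apply, ← h1]
    rcases Nat.eq_zero_or_pos N with h0 | hpos
    · have := hN h0
      have : d = 0 := Subsingleton.elim _ _
      subst this
      simp [Function.comp_def]
    · have h2 := iteratedDeriv_taylorFlow_smul a hpos u d
      rw [iteratedDeriv_one] at h2
      simp only [Function.comp_def]
      rw [h2]
      simp [dirD]

/-- Near a point `(u, 0)` where `a u` is invertible, `(u, v) ↦ (u, taylorFlow a N (u, v))` is a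
local diffeomorphism. -/
theorem exists_taylorFlow_homeomorph [CompleteSpace E] [CompleteSpace V] {a : E → V →L[ℝ] E}
    {A : Set E} (hA : IsOpen A) (ha : ContDiffOn ℝ ∞ a A) {u : E} (hu : u ∈ A) {N : ℕ}
    (hN : N = 0 → Subsingleton V) (hbij : Function.Bijective (a u)) :
    ∃ e : OpenPartialHomeomorph (E × V) (E × E), (u, 0) ∈ e.source ∧ e.source ⊆ A ×ˢ univ ∧
      (∀ p, e p = (p.1, taylorFlow a N p)) ∧ ContDiffOn ℝ ∞ e.symm e.target := by
  set Θ : E × V → E × E := fun p => (p.1, taylorFlow a N p) with hΘ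
  have hO : IsOpen (A ×ˢ (univ : Set V)) := hA.prod isOpen_univ
  have hmem : (u, (0 : V)) ∈ A ×ˢ (univ : Set V) := ⟨hu, mem_univ _⟩
  have hsm : ContDiffOn ℝ ∞ Θ (A ×ˢ univ) := contDiffOn_fst.prodMk (contDiffOn_taylorFlow hA ha N)
  set l : E × V →L[ℝ] E × E := (ContinuousLinearMap.fst ℝ E V).prod
    (ContinuousLinearMap.fst ℝ E V + (a u).comp (ContinuousLinearMap.snd ℝ E V)) with hl
  have hder : HasFDerivAt Θ l (u, 0) := hasFDerivAt_fst.prodMk (hasFDerivAt_taylorFlow_zero hA ha hu hN)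
  have hlb : Function.Bijective l := by
    constructor
    · rintro ⟨x, y⟩ ⟨x', y'⟩ h
      simp only [hl, ContinuousLinearMap.prod_apply, ContinuousLinearMap.coe_fst', Prod.mk.injEq,
        add_apply, ContinuousLinearMap.comp_apply,
        ContinuousLinearMap.coe_snd'] at h
      obtain ⟨rfl, h⟩ := h
      rw [hbij.1 (add_left_cancel h)]
    · rintro ⟨x, y⟩
      obtain ⟨v, hv⟩ := hbij.2 (y - x)
      exact ⟨(x, v), by simp [hl, hv]⟩
  set L : (E × V) ≃L[ℝ] (E × E) := ContinuousLinearEquiv.ofBijective l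
    (LinearMap.ker_eq_bot.mpr hlb.1) (LinearMap.range_eq_top.mpr hlb.2) with hL
  have hder' : HasFDerivAt Θ (L : E × V →L[ℝ] E × E) (u, 0) := by
    rw [hL, ContinuousLinearEquiv.coe_ofBijective]
    exact hder
  set e₀ := (hsm.contDiffAt (hO.mem_nhds hmem)).toOpenPartialHomeomorph Θ hder' (by simp)
  -- Restricting to the points where the derivative is invertible makes the inverse smooth on the
  -- whole target, not just near the image of `(u, 0)`.
  set B : Set (E × V) := (A ×ˢ univ) ∩
    fderiv ℝ Θ ⁻¹' range ((↑) : ((E × V) ≃L[ℝ] (E × E)) → (E × V →L[ℝ] E × E)) with hB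
  have hBo : IsOpen B := (hsm.continuousOn_fderiv_of_isOpen hO (by simp)).isOpen_inter_preimage hO
    ContinuousLinearEquiv.isOpen
  refine ⟨e₀.restrOpen B hBo, ⟨ContDiffAt.mem_toOpenPartialHomeomorph_source _ _ _, hmem,
    L, hder'.fderiv.symm⟩, fun p hp => hp.2.1, fun p => rfl, fun q hq => ?_⟩
  have hp := (e₀.restrOpen B hBo).map_target hq
  obtain ⟨L', hL'⟩ := hp.2.2
  refine ((e₀.restrOpen B hBo).contDiffAt_symm (f₀' := L') hq ?_ ?_).contDiffWithinAt
  · rw [hL']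
    exact ((hsm.contDiffAt (hO.mem_nhds hp.2.1)).differentiableAt (by simp)).hasFDerivAt
  · exact hsm.contDiffAt (hO.mem_nhds hp.2.1)

end Jets

/-! ### Existence of exponential charts. -/

section ChartExistence

open Set Filter

variable {n : ℕ} {M : Type*} [TopologicalSpace M] [ChartedSpace (Vec n) M]

/-- The vector field `V` read in the chart at `x₀`. -/
def chartField (x₀ : M) (V : ∀ y : M, TangentSpace 𝓘(ℝ, Vec n) y) (u : Vec n) : Vec n :=
  (mfderiv 𝓘(ℝ, Vec n) 𝓘(ℝ, Vec n) (chartAt (Vec n) x₀) ((chartAt (Vec n) x₀).symm u)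
    (V ((chartAt (Vec n) x₀).symm u)) : Vec n)

theorem chartField_chart {x₀ y : M} (V : ∀ y : M, TangentSpace 𝓘(ℝ, Vec n) y)
    (hy : y ∈ (chartAt (Vec n) x₀).source) : chartField x₀ V (chartAt (Vec n) x₀ y) =
      (mfderiv 𝓘(ℝ, Vec n) 𝓘(ℝ, Vec n) (chartAt (Vec n) x₀) y (V y) : Vec n) := by
  have h : ∀ z, z = y →
      (mfderiv 𝓘(ℝ, Vec n) 𝓘(ℝ, Vec n) (chartAt (Vec n) x₀) z (V z) : Vec n) =
        (mfderiv 𝓘(ℝ, Vec n) 𝓘(ℝ, Vec n) (chartAt (Vec n) x₀) y (V y) : Vec n) := by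
    rintro z rfl
    rfl
  exact h _ ((chartAt (Vec n) x₀).left_inv hy)

/-- The linear map `v ↦ ∑ v_j X_j(u)` of a frame read in the chart at `x₀`. -/
def chartFrame (x₀ : M) (X : Fin n → ∀ y : M, TangentSpace 𝓘(ℝ, Vec n) y) (u : Vec n) :
    Vec n →L[ℝ] Vec n :=
  ∑ j, (EuclideanSpace.proj j : Vec n →L[ℝ] ℝ).smulRight (chartField x₀ (X j) u)

theorem chartFrame_apply (x₀ : M) (X : Fin n → ∀ y : M, TangentSpace 𝓘(ℝ, Vec n) y)
    (u v : Vec n) : chartFrame x₀ X u v = ∑ j, v j • chartField x₀ (X j) u := by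
  simp [chartFrame]

theorem chartFrame_apply_chart {x₀ y : M} (X : Fin n → ∀ y : M, TangentSpace 𝓘(ℝ, Vec n) y)
    (hy : y ∈ (chartAt (Vec n) x₀).source) (v : Vec n) :
    chartFrame x₀ X (chartAt (Vec n) x₀ y) v =
      (mfderiv 𝓘(ℝ, Vec n) 𝓘(ℝ, Vec n) (chartAt (Vec n) x₀) y (∑ j, v j • X j y) : Vec n) := by
  rw [chartFrame_apply]
  simp only [chartField_chart _ hy, map_sum, map_smul]
  rfl

/-- The domain in the chart at `x₀` of objects defined on `U`. -/
def chartDom (x₀ : M) (U : Set M) : Set (Vec n) :=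
  (chartAt (Vec n) x₀).target ∩ (chartAt (Vec n) x₀).symm ⁻¹' U

theorem isOpen_chartDom (x₀ : M) {U : Set M} (hU : IsOpen U) :
    IsOpen (chartDom (n := n) x₀ U) :=
  (chartAt (Vec n) x₀).isOpen_inter_preimage_symm hU

variable [IsManifold 𝓘(ℝ, Vec n) ∞ M]

theorem contDiffOn_chartField (x₀ : M) {V : ∀ y : M, TangentSpace 𝓘(ℝ, Vec n) y} {U : Set M}
    (hV : SmoothVF V U) : ContDiffOn ℝ ∞ (chartField x₀ V) (chartDom x₀ U) := by
  set φ := chartAt (Vec n) x₀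
  have h1 : ContMDiffOn 𝓘(ℝ, Vec n) 𝓘(ℝ, Vec n) ∞ φ φ.source := contMDiffOn_chart
  have h2 := h1.contMDiffOn_tangentMapWithin (m := ∞) (by simp) φ.open_source.uniqueMDiffOn
  have h3 : ContMDiffOn 𝓘(ℝ, Vec n) 𝓘(ℝ, Vec n) ∞ φ.symm φ.target := contMDiffOn_chart_symm
  have h4 := (contMDiff_snd_tangentBundle_modelSpace (n := ∞) (Vec n)
    𝓘(ℝ, Vec n)).comp_contMDiffOn
    (h2.comp (hV.comp (h3.mono inter_subset_left) fun u hu => hu.2)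
      (s := chartDom x₀ U) fun u hu => φ.map_target hu.1)
  refine contMDiffOn_iff_contDiffOn.mp (h4.congr fun u hu => ?_)
  have h5 := mfderivWithin_of_isOpen (I := 𝓘(ℝ, Vec n)) (I' := 𝓘(ℝ, Vec n)) (f := φ)
    φ.open_source (φ.map_target hu.1)
  exact (congrArg (fun l => l (V (φ.symm u))) h5).symm

theorem contDiffOn_chartFrame (x₀ : M) {X : Fin n → ∀ y : M, TangentSpace 𝓘(ℝ, Vec n) y}
    {U : Set M} (hX : ∀ j, SmoothVF (X j) U) :
    ContDiffOn ℝ ∞ (chartFrame x₀ X) (chartDom x₀ U) := by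
  refine ContDiffOn.sum fun j _ => ?_
  exact contDiffOn_const.smulRight (contDiffOn_chartField x₀ (hX j))

theorem lieD_eq_fderiv {x₀ y : M} (hy : y ∈ (chartAt (Vec n) x₀).source)
    (V : ∀ y : M, TangentSpace 𝓘(ℝ, Vec n) y) {f : M → ℝ} {g : Vec n → ℝ}
    (hg : DifferentiableAt ℝ g (chartAt (Vec n) x₀ y))
    (hfg : f =ᶠ[𝓝 y] fun z => g (chartAt (Vec n) x₀ z)) :
    lieD V f y = fderiv ℝ g (chartAt (Vec n) x₀ y)
      (mfderiv 𝓘(ℝ, Vec n) 𝓘(ℝ, Vec n) (chartAt (Vec n) x₀) y (V y) : Vec n) := by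
  unfold lieD
  have h1 : MDifferentiableAt 𝓘(ℝ, Vec n) 𝓘(ℝ, Vec n) (chartAt (Vec n) x₀) y :=
    mdifferentiableAt_extChartAt (I := 𝓘(ℝ, Vec n)) hy
  have h2 : MDifferentiableAt 𝓘(ℝ, Vec n) 𝓘(ℝ, ℝ) g (chartAt (Vec n) x₀ y) :=
    hg.mdifferentiableAt
  rw [hfg.mfderiv_eq]
  have := mfderiv_comp y h2 h1
  rw [Function.comp_def] at this
  rw [this, mfderiv_eq_fderiv]
  rfl

theorem lieD_iterate_eq_dirD {x₀ : M} {X : Fin n → ∀ y : M, TangentSpace 𝓘(ℝ, Vec n) y}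
    {U : Set M} (hU : IsOpen U) (hX : ∀ j, SmoothVF (X j) U) {f : M → ℝ}
    (hf : ContMDiff 𝓘(ℝ, Vec n) 𝓘(ℝ, ℝ) ∞ f) (v : Vec n) (k : ℕ) {y : M} (hyU : y ∈ U)
    (hy : y ∈ (chartAt (Vec n) x₀).source) :
    ((lieD fun y => ∑ j, v j • X j y)^[k] f) y =
      (dirD (chartFrame x₀ X) v)^[k] (f ∘ (chartAt (Vec n) x₀).symm) (chartAt (Vec n) x₀ y) := by
  set φ := chartAt (Vec n) x₀
  have hA := isOpen_chartDom (n := n) x₀ hU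
  have hg : ContDiffOn ℝ ∞ (f ∘ φ.symm) (chartDom x₀ U) :=
    contMDiffOn_iff_contDiffOn.mp (hf.comp_contMDiffOn
      ((contMDiffOn_chart_symm (I := 𝓘(ℝ, Vec n))).mono inter_subset_left))
  induction k generalizing y with
  | zero => simp [φ.left_inv hy]
  | succ k ih =>
    have hyA : φ y ∈ chartDom x₀ U := ⟨φ.map_source hy, by
      change φ.symm (φ y) ∈ U
      rwa [φ.left_inv hy]⟩
    have hs : ContDiffOn ℝ ∞ ((dirD (chartFrame x₀ X) v)^[k] (f ∘ φ.symm)) (chartDom x₀ U) :=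
      (contDiffOn_dirD_iterate hA (contDiffOn_chartFrame x₀ hX) hg k).comp
        (contDiff_prodMk_left v).contDiffOn fun u hu => ⟨hu, mem_univ _⟩
    rw [Function.iterate_succ_apply', Function.iterate_succ_apply',
      lieD_eq_fderiv hy _ ((hs.contDiffAt (hA.mem_nhds hyA)).differentiableAt (by simp)) ?_]
    · rw [dirD, chartFrame_apply_chart X hy]
    · filter_upwards [hU.mem_nhds hyU, φ.open_source.mem_nhds hy] with z hz hz'
      exact ih hz hz'

theorem bijective_chartFrame {x₀ y : M} {X : Fin n → ∀ y : M, TangentSpace 𝓘(ℝ, Vec n) y}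
    (hX : LinearIndependent ℝ fun j => X j y) (hy : y ∈ (chartAt (Vec n) x₀).source) :
    Function.Bijective (chartFrame x₀ X (chartAt (Vec n) x₀ y)) := by
  have hinj : Function.Injective (chartFrame x₀ X (chartAt (Vec n) x₀ y)) := by
    refine (injective_iff_map_eq_zero _).mpr fun v hv => ?_
    rw [chartFrame_apply_chart X hy] at hv
    have hi : (mfderiv 𝓘(ℝ, Vec n) 𝓘(ℝ, Vec n) (chartAt (Vec n) x₀) y).IsInvertible :=
      isInvertible_mfderiv_extChartAt (I := 𝓘(ℝ, Vec n)) (x := x₀) (by simpa using hy)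
    have h0 : ∑ j, v j • X j y = 0 := hi.injective (hv.trans (map_zero _).symm)
    ext j
    exact Fintype.linearIndependent_iff.mp hX _ h0 j
  exact ⟨hinj, LinearMap.injective_iff_surjective (f := (chartFrame x₀ X
    (chartAt (Vec n) x₀ y)).toLinearMap).mp hinj⟩

theorem FilteredManifold.subsingleton_of_depth_eq_zero (F : FilteredManifold n M)
    (h : F.depth = 0) : Subsingleton (Vec n) := by
  have hn : IsEmpty (Fin n) := ⟨fun j => by
    have h1 : F.w j ≤ F.depth := Finset.le_sup (f := F.w) (Finset.mem_univ j)
    have h2 := F.w_pos j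
    omega⟩
  exact ⟨fun a b => by ext j; exact hn.elim j⟩

/-- Every point lies in the domain of an exponential chart. -/
theorem exists_expChart (F : FilteredManifold n M) (x₀ : M) : ∃ c : ExpChart F, x₀ ∈ c.U := by
  set φ := chartAt (Vec n) x₀ with hφ
  obtain ⟨U₁, X, hU₁, hx₀, hX, had⟩ := F.exists_frame x₀
  have hsrc : x₀ ∈ φ.source := mem_chart_source _ x₀
  have hA := isOpen_chartDom (n := n) x₀ hU₁
  have ha := contDiffOn_chartFrame x₀ hX
  have hx₀A : φ x₀ ∈ chartDom x₀ U₁ := ⟨φ.map_source hsrc, by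
    change φ.symm (φ x₀) ∈ U₁
    rwa [φ.left_inv hsrc]⟩
  obtain ⟨e, hmem, hsub, he, hsymm⟩ := exists_taylorFlow_homeomorph hA ha hx₀A
    (N := F.depth) F.subsingleton_of_depth_eq_zero
    (bijective_chartFrame (had x₀ hx₀).linearIndependent hsrc)
  set P := taylorFlow (chartFrame x₀ X) F.depth with hP
  have hesymm : ∀ q ∈ e.target, (q.1, (e.symm q).2) = e.symm q := fun q hq => by
    have := congrArg Prod.fst (e.right_inv hq)
    rw [he] at this
    exact Prod.ext this.symm rfl
  have hPe : ∀ q ∈ e.target, P (e.symm q) = q.2 := fun q hq => by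
    have := congrArg Prod.snd (e.right_inv hq)
    rwa [he] at this
  have hSo : IsOpen (e.source ∩ e ⁻¹' (univ ×ˢ φ.target)) :=
    e.isOpen_inter_preimage (isOpen_univ.prod φ.open_target)
  -- The condition on `φ.target` ensures that the value of the polynomial can be carried back to
  -- `M`.
  set Ω₀ : Set (M × Vec n) := (φ.source ×ˢ univ) ∩ (fun p => (φ p.1, p.2)) ⁻¹'
    (e.source ∩ e ⁻¹' (univ ×ˢ φ.target)) with hΩ₀
  have hΩ₀o : IsOpen Ω₀ := by
    refine ContinuousOn.isOpen_inter_preimage ?_ (φ.open_source.prod isOpen_univ) hSo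
    exact (φ.continuousOn.comp continuousOn_fst fun p hp => hp.1).prodMk continuousOn_snd
  -- The base consists of the points whose zero vector already lies in `Ω₀`, so the zero section is
  -- in the domain; `Ω` is then cut down to lie over `U`.
  set U : Set M := (fun x => (x, (0 : Vec n))) ⁻¹' Ω₀ with hU
  have hUo : IsOpen U := hΩ₀o.preimage (by fun_prop)
  have hUsrc : U ⊆ φ.source := fun x hx => hx.1.1
  have hUU₁ : U ⊆ U₁ := fun x hx => by
    have h1 : φ.symm (φ x) ∈ U₁ := (hsub hx.2.1).1.2
    rwa [φ.left_inv (hUsrc hx)] at h1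
  have hφs : ContMDiffOn 𝓘(ℝ, Vec n) 𝓘(ℝ, Vec n) ∞ φ φ.source := contMDiffOn_chart
  have hφt : ContMDiffOn 𝓘(ℝ, Vec n) 𝓘(ℝ, Vec n) ∞ φ.symm φ.target := contMDiffOn_chart_symm
  set W : Set (M × M) := (U ×ˢ φ.source) ∩ (fun q => (φ q.1, φ q.2)) ⁻¹' e.target with hW
  refine ⟨{
    U := U
    X := X
    Ω := Ω₀ ∩ (U ×ˢ univ)
    E := fun p => φ.symm (P (φ p.1, p.2))
    W := W
    L := fun q => (e.symm (φ q.1, φ q.2)).2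
    isOpen_U := hUo
    smooth_X := fun j => (hX j).mono hUU₁
    adapted := fun x hx => had x (hUU₁ hx)
    isOpen_Ω := hΩ₀o.inter (hUo.prod isOpen_univ)
    fst_mem := fun p hp => hp.2.1
    zero_mem := fun x hx => ⟨hx, hx, mem_univ _⟩
    smooth_E := ?_
    isOpen_W := ?_
    smooth_L := ?_
    mapsTo := ?_
    left_inv := ?_
    mapsTo_symm := ?_
    right_inv := ?_
    jet_eq := ?_ }, ?_⟩
  · have h1 : ContMDiffOn (𝓘(ℝ, Vec n).prod 𝓘(ℝ, Vec n)) 𝓘(ℝ, Vec n × Vec n) ∞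
        (fun p : M × Vec n => (φ p.1, p.2)) (Ω₀ ∩ (U ×ˢ univ)) :=
      (hφs.comp contMDiffOn_fst fun p hp => hp.1.1.1).prodMk_space contMDiffOn_snd
    refine hφt.comp ((contDiffOn_taylorFlow hA ha F.depth).contMDiffOn.comp h1
      fun p hp => hsub hp.1.2.1) fun p hp => ?_
    have := hp.1.2.2.2
    rwa [he] at this
  · refine ContinuousOn.isOpen_inter_preimage ?_ (hUo.prod φ.open_source) e.open_target
    exact (φ.continuousOn.comp continuousOn_fst fun p hp => hUsrc hp.1).prodMk
      (φ.continuousOn.comp continuousOn_snd fun p hp => hp.2)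
  · have h1 : ContMDiffOn (𝓘(ℝ, Vec n).prod 𝓘(ℝ, Vec n)) 𝓘(ℝ, Vec n × Vec n) ∞
        (fun q : M × M => (φ q.1, φ q.2)) W :=
      (hφs.comp contMDiffOn_fst fun p hp => hUsrc hp.1.1).prodMk_space
        (hφs.comp contMDiffOn_snd fun p hp => hp.1.2)
    have h2 : ContDiffOn ℝ ∞ (fun q => (e.symm q).2) e.target := contDiff_snd.comp_contDiffOn hsymm
    exact h2.contMDiffOn.comp h1 fun q hq => hq.2
  · intro p hp
    have h1 : P (φ p.1, p.2) ∈ φ.target := by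
      have := hp.1.2.2.2
      rwa [he] at this
    refine ⟨⟨hp.2.1, φ.map_target h1⟩, ?_⟩
    change (φ p.1, φ (φ.symm _)) ∈ e.target
    rw [φ.right_inv h1, ← he (φ p.1, p.2)]
    exact e.map_source hp.1.2.1
  · intro p hp
    have h1 : P (φ p.1, p.2) ∈ φ.target := by
      have := hp.1.2.2.2
      rwa [he] at this
    change (e.symm (φ p.1, φ (φ.symm _))).2 = _
    rw [φ.right_inv h1, ← he (φ p.1, p.2), e.left_inv hp.1.2.1]
  · intro q hq
    refine ⟨⟨⟨hUsrc hq.1.1, mem_univ _⟩, ?_⟩, hq.1.1, mem_univ _⟩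
    change (φ q.1, (e.symm (φ q.1, φ q.2)).2) ∈ e.source ∩ e ⁻¹' (univ ×ˢ φ.target)
    rw [hesymm _ hq.2]
    refine ⟨e.map_target hq.2, mem_univ _, ?_⟩
    rw [e.right_inv hq.2]
    exact φ.map_source hq.1.2
  · intro q hq
    change φ.symm (P (φ q.1, (e.symm (φ q.1, φ q.2)).2)) = q.2
    rw [hesymm _ hq.2, hPe _ hq.2]
    exact φ.left_inv hq.1.2
  · intro x hx v f hf k hk
    have hxA : φ x ∈ chartDom x₀ U₁ := (hsub hx.2.1).1
    have hg : ContDiffOn ℝ ∞ (f ∘ φ.symm) (chartDom x₀ U₁) :=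
      contMDiffOn_iff_contDiffOn.mp (hf.comp_contMDiffOn (hφt.mono inter_subset_left))
    rw [lieD_iterate_eq_dirD hU₁ hX hf v k (hUU₁ hx) (hUsrc hx)]
    exact iteratedDeriv_comp_taylorFlow hA ha hg hxA v hk
  · refine ⟨⟨hsrc, mem_univ _⟩, hmem, mem_univ _, ?_⟩
    rw [he]
    change P (φ x₀, 0) ∈ φ.target
    rw [hP, taylorFlow_zero]
    exact φ.map_source hsrc

end ChartExistence

/-! ### The fibre of the groupoid over `(x, 0)`. -/

section Fibre

open Set Filter

variable {n : ℕ} {M : Type*} [TopologicalSpace M] [ChartedSpace (Vec n) M]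
  [IsManifold 𝓘(ℝ, Vec n) ∞ M] {F : FilteredManifold n M}

/-- `oscCoord` as a linear map. -/
def oscCoordLin {x : M} {b : Fin n → TangentSpace 𝓘(ℝ, Vec n) x} (hb : F.IsAdapted x b) :
    Vec n →ₗ[ℝ] F.Osc x where
  toFun := oscCoord hb
  map_add' v v' := by
    funext i
    simp only [oscCoord, Pi.add_apply, ← Submodule.Quotient.mk_add]
    congr 1
    apply Subtype.ext
    simp [add_smul, Finset.sum_add_distrib]
  map_smul' r v := by
    funext i
    simp only [oscCoord, Pi.smul_apply, ← Submodule.Quotient.mk_smul]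
    congr 1
    apply Subtype.ext
    simp [Finset.smul_sum, smul_smul]

/-- If the class in degree `i + 1` vanishes, a combination of basis vectors of weight `i + 1` lies
in the span of those of weight at most `i`, and independence makes it trivial. Weights are positive,
so every index is reached. -/
theorem injective_oscCoordLin {x : M} {b : Fin n → TangentSpace 𝓘(ℝ, Vec n) x}
    (hb : F.IsAdapted x b) : Function.Injective (oscCoordLin hb) := by
  refine (injective_iff_map_eq_zero _).mpr fun v hv => ?_
  ext j
  obtain ⟨i, hi⟩ : ∃ i, F.w j = i + 1 := ⟨F.w j - 1, by have := F.w_pos j; omega⟩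
  have h1 := congrFun hv i
  simp only [oscCoordLin, LinearMap.coe_mk, AddHom.coe_mk, oscCoord, Pi.zero_apply] at h1
  rw [Submodule.Quotient.mk_eq_zero] at h1
  change _ ∈ F.H i x at h1
  rw [show F.H i x = _ from hb.span_eq i] at h1
  have h2 : ∑ j ∈ Finset.univ.filter (fun j => F.w j = i + 1), v j • b j ∈
      Submodule.span ℝ (b '' {j | F.w j = i + 1}) :=
    Submodule.sum_mem _ fun j hj => Submodule.smul_mem _ _
      (Submodule.subset_span ⟨j, (Finset.mem_filter.mp hj).2, rfl⟩)
  have hdis : Disjoint {j | F.w j = i + 1} {j | F.w j ≤ i} :=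
    Set.disjoint_left.mpr fun k hk hk' => by
      simp only [mem_ofPred_eq] at hk hk'
      omega
  have h3 := Submodule.disjoint_def.mp (hb.linearIndependent.disjoint_span_image hdis) _ h2 h1
  exact linearIndependent_iff'.mp hb.linearIndependent _ _ h3 j (by simp [hi])

theorem surjective_oscCoordLin {x : M} {b : Fin n → TangentSpace 𝓘(ℝ, Vec n) x}
    (hb : F.IsAdapted x b) : Function.Surjective (oscCoordLin hb) := by
  intro ξ
  have h : ∀ i, ∃ c : Fin n → ℝ, ∃ h : ∑ j ∈ Finset.univ.filter (fun j => F.w j ≤ i + 1),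
      c j • b j ∈ F.H (i + 1) x, ξ i = Submodule.Quotient.mk ⟨_, h⟩ := by
    intro i
    obtain ⟨⟨y, hy⟩, hyξ⟩ := Submodule.Quotient.mk_surjective _ (ξ i)
    have hy' : y ∈ Submodule.span ℝ (b '' {j | F.w j ≤ i + 1}) := by
      rwa [← show F.H (i + 1) x = _ from hb.span_eq (i + 1)]
    have hs : b '' {j | F.w j ≤ i + 1} =
        b '' ((Finset.univ.filter (fun j => F.w j ≤ i + 1) : Finset (Fin n)) : Set (Fin n)) := by
      simp
    rw [hs, Submodule.mem_span_image_finset_iff_exists_fun'] at hy'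
    obtain ⟨c, hc⟩ := hy'
    refine ⟨c, hc ▸ hy, ?_⟩
    rw [← hyξ]
    congr 1
    exact Subtype.ext hc.symm
  choose c hc hξ using h
  -- The vector `b j` is seen only by the factor of `Osc` with index `F.w j - 1`, so its coefficient
  -- is taken from the representative chosen there; the part of weight at most `i` dies in the
  -- quotient.
  refine ⟨WithLp.toLp 2 fun j => c (F.w j - 1) j, ?_⟩
  funext i
  rw [hξ i]
  simp only [oscCoordLin, LinearMap.coe_mk, AddHom.coe_mk, oscCoord]
  rw [eq_comm, Submodule.Quotient.eq]
  change _ ∈ F.H i x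
  have hsplit : ∑ j ∈ Finset.univ.filter (fun j => F.w j ≤ i + 1), c i j • b j =
      ∑ j ∈ Finset.univ.filter (fun j => F.w j ≤ i), c i j • b j +
      ∑ j ∈ Finset.univ.filter (fun j => F.w j = i + 1), c i j • b j := by
    rw [← Finset.sum_union]
    · congr 1
      ext j
      simp
      omega
    · refine Finset.disjoint_left.mpr fun j hj hj' => ?_
      simp at hj hj'
      omega
  have heq : ∑ j ∈ Finset.univ.filter (fun j => F.w j = i + 1), c (F.w j - 1) j • b j =
      ∑ j ∈ Finset.univ.filter (fun j => F.w j = i + 1), c i j • b j := by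
    refine Finset.sum_congr rfl fun j hj => ?_
    rw [(Finset.mem_filter.mp hj).2, Nat.add_sub_cancel]
  simp only [Submodule.subtype_apply, AddSubgroupClass.coe_sub]
  rw [heq, hsplit, add_sub_cancel_right, show F.H i x = _ from hb.span_eq i]
  exact Submodule.sum_mem _ fun j hj => Submodule.smul_mem _ _
    (Submodule.subset_span ⟨j, (Finset.mem_filter.mp hj).2, rfl⟩)

/-- `oscCoord` as a linear equivalence. -/
def oscCoordEquiv {x : M} {b : Fin n → TangentSpace 𝓘(ℝ, Vec n) x} (hb : F.IsAdapted x b) :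
    Vec n ≃ₗ[ℝ] F.Osc x :=
  LinearEquiv.ofBijective (oscCoordLin hb) ⟨injective_oscCoordLin hb, surjective_oscCoordLin hb⟩

theorem oscCoordEquiv_apply {x : M} {b : Fin n → TangentSpace 𝓘(ℝ, Vec n) x}
    (hb : F.IsAdapted x b) (v : Vec n) : oscCoordEquiv hb v = oscCoord hb v := rfl

/-- The parametrization of the fibre over `(x, 0)` of the groupoid by an adapted basis. -/
def oscFibre {x : M} {b : Fin n → TangentSpace 𝓘(ℝ, Vec n) x} (hb : F.IsAdapted x b)
    (v : Vec n) : TangentGroupoid F := .osc x (oscCoord hb v)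

theorem oscFibre_zero {x : M} {b : Fin n → TangentSpace 𝓘(ℝ, Vec n) x} (hb : F.IsAdapted x b) :
    oscFibre hb 0 = .osc x 0 := by
  rw [oscFibre, ← oscCoordEquiv_apply, map_zero]

theorem zoom_oscFibre {x : M} {b : Fin n → TangentSpace 𝓘(ℝ, Vec n) x} (hb : F.IsAdapted x b)
    (s : {s : ℝ // 0 < s}) (v : Vec n) :
    (oscFibre hb v).zoom s = oscFibre hb (F.dil s v) := by
  simp [oscFibre, TangentGroupoid.zoom, oscDil_oscCoord]

theorem injective_oscFibre {x : M} {b : Fin n → TangentSpace 𝓘(ℝ, Vec n) x}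
    (hb : F.IsAdapted x b) : Function.Injective (oscFibre hb) := by
  intro v v' h
  simp only [oscFibre, TangentGroupoid.osc.injEq, heq_eq_eq, true_and] at h
  exact injective_oscCoordLin hb h

theorem dil_zero (v : Vec n) : F.dil 0 v = 0 := by
  ext j
  simp [FilteredManifold.dil, (Nat.one_le_iff_ne_zero.mp (F.w_pos j))]

theorem ExpChart.fibre_mem_dom (c : ExpChart F) {x : M} (hx : x ∈ c.U) (v : Vec n) :
    (x, v, (0 : ℝ)) ∈ c.dom := by
  simpa [ExpChart.dom, dil_zero] using c.zero_mem x hx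

theorem ExpChart.param_fibre (c : ExpChart F) {x : M} (hx : x ∈ c.U) (v : Vec n) :
    c.param ⟨(x, v, 0), c.fibre_mem_dom hx v⟩ = oscFibre (c.adapted x hx) v := by
  simp [ExpChart.param, oscFibre]

theorem ExpChart.continuous_param (c : ExpChart F) : Continuous c.param := by
  rw [continuous_iff_coinduced_le]
  exact (le_iSup (fun c : ExpChart F =>
    TopologicalSpace.coinduced c.param inferInstance) c).trans le_sup_right

theorem ExpChart.continuous_oscFibre (c : ExpChart F) {x : M} (hx : x ∈ c.U) :
    Continuous (oscFibre (c.adapted x hx)) := by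
  have h : Continuous fun v : Vec n =>
      (⟨(x, v, 0), c.fibre_mem_dom hx v⟩ : c.dom) := by fun_prop
  simpa only [Function.comp_def, c.param_fibre hx] using c.continuous_param.comp h

/-- The topology is coinduced, so closedness is tested piecewise. The fibre does not meet `M × M ×
ℝ^*`. In a chart over `x` the preimage is cut out by `y = x`, by `t = 0` and by a closed condition
read through the linear change between two adapted bases; in a chart not over `x` it is empty. -/
theorem isClosedMap_oscFibre [T2Space M] {x : M} {b : Fin n → TangentSpace 𝓘(ℝ, Vec n) x}
    (hb : F.IsAdapted x b) : IsClosedMap (oscFibre hb) := by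
  intro A hA
  rw [← isOpen_compl_iff]
  refine ⟨?_, ?_⟩
  · change IsOpen ((fun p : {p : M × (M × ℝ) // p.2.2 ≠ 0} => TangentGroupoid.incl F p.1) ⁻¹'
      (oscFibre hb '' A)ᶜ)
    convert isOpen_univ
    refine eq_univ_of_forall fun p => ?_
    rintro ⟨v, _, hv⟩
    simp [TangentGroupoid.incl, p.2, oscFibre] at hv
  · refine isOpen_iSup_iff.mpr fun c => isOpen_coinduced.mpr ?_
    rw [preimage_compl, isOpen_compl_iff]
    by_cases hx : x ∈ c.U
    · have heq : c.param ⁻¹' (oscFibre hb '' A) = {p : c.dom | p.1.1 = x ∧ p.1.2.2 = 0 ∧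
          (oscCoordEquiv hb).symm (oscCoordEquiv (c.adapted x hx) p.1.2.1) ∈ A} := by
        ext ⟨⟨y, v, t⟩, hp⟩
        simp only [mem_preimage, mem_image, mem_ofPred_eq]
        constructor
        · rintro ⟨v', hv', h⟩
          unfold ExpChart.param oscFibre at h
          split_ifs at h with ht
          simp only [TangentGroupoid.osc.injEq] at h
          obtain ⟨rfl, h⟩ := h
          refine ⟨rfl, by simpa using ht, ?_⟩
          rw [oscCoordEquiv_apply, ← eq_of_heq h, ← oscCoordEquiv_apply,
            LinearEquiv.symm_apply_apply]
          exact hv'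
        · rintro ⟨rfl, rfl, h⟩
          refine ⟨_, h, ?_⟩
          rw [c.param_fibre hx, oscFibre, ← oscCoordEquiv_apply, LinearEquiv.apply_symm_apply]
          rfl
      rw [heq]
      have hc : Continuous ((oscCoordEquiv hb).symm.toLinearMap ∘ₗ
        (oscCoordEquiv (c.adapted x hx)).toLinearMap) := LinearMap.continuous_of_finiteDimensional _
      refine IsClosed.inter (isClosed_eq (by fun_prop) continuous_const)
        (IsClosed.inter (isClosed_eq (by fun_prop) continuous_const) ?_)
      exact hA.preimage (hc.comp (by fun_prop : Continuous fun p : c.dom => p.1.2.1))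
    · convert isClosed_empty
      refine eq_empty_of_forall_notMem fun p => ?_
      rintro ⟨v, _, hv⟩
      have h1 := congrArg TangentGroupoid.range hv
      rw [c.range_param] at h1
      have h2 : p.1.1 = x := (congrArg Prod.fst h1).symm
      exact hx (h2 ▸ c.fst_mem _ p.2)

/-- Properness over the single point `(x, 0)` gives a compact set, and a closed embedding pulls it
back to a compact set. -/
theorem ExpChart.hasCompactSupport_comp_oscFibre [T2Space M] (c : ExpChart F) {x : M}
    (hx : x ∈ c.U) {g : TangentGroupoid F → ℂ} (hg : IsProperSet (tsupport g)) :
    HasCompactSupport fun v => g (oscFibre (c.adapted x hx) v) := by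
  have hemb : Topology.IsClosedEmbedding (oscFibre (c.adapted x hx)) :=
    .of_continuous_injective_isClosedMap (c.continuous_oscFibre hx) (injective_oscFibre _)
      (isClosedMap_oscFibre _)
  refine HasCompactSupport.of_support_subset_isCompact
    (hemb.isCompact_preimage (hg {(x, 0)} isCompact_singleton).1) fun v hv => ⟨?_, rfl⟩
  exact subset_tsupport g hv

theorem ExpChart.continuous_comp_oscFibre (c : ExpChart F) {x : M} (hx : x ∈ c.U)
    (f : smoothFun F) : Continuous fun v => f.1 (oscFibre (c.adapted x hx) v) := by
  have hf : IsSmooth f.1 := f.2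
  have h1 : Continuous fun v : Vec n => c.read f.1 (x, v, 0) :=
    (hf.chart c).continuousOn.comp_continuous (by fun_prop) fun v => c.fibre_mem_dom hx v
  simpa only [c.read_of_mem _ (c.fibre_mem_dom hx _), c.param_fibre hx] using h1

end Fibre

/-! ### Integration on the fibre and the cocycle identity. -/

section FibreIntegral

open Set Filter
open scoped ComplexConjugate

variable {n : ℕ} {M : Type*} [TopologicalSpace M] [ChartedSpace (Vec n) M]
  [IsManifold 𝓘(ℝ, Vec n) ∞ M] {F : FilteredManifold n M}

theorem continuous_dil (s : ℝ) : Continuous (F.dil s) := by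
  unfold FilteredManifold.dil
  fun_prop

theorem dil_one (v : Vec n) : F.dil 1 v = v := by
  ext j
  simp [FilteredManifold.dil]

variable (F) in
/-- The dilation by `s > 0` as a homeomorphism. -/
def dilHomeomorph (s : {s : ℝ // 0 < s}) : Vec n ≃ₜ Vec n where
  toFun := F.dil s
  invFun := F.dil (s : ℝ)⁻¹
  left_inv v := by rw [dil_dil, inv_mul_cancel₀ s.2.ne', dil_one]
  right_inv v := by rw [dil_dil, mul_inv_cancel₀ s.2.ne', dil_one]
  continuous_toFun := continuous_dil _
  continuous_invFun := continuous_dil _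

variable (F) in
/-- The dilations as linear maps. -/
def dilLin (s : ℝ) : Vec n →ₗ[ℝ] Vec n :=
  Matrix.toLin (EuclideanSpace.basisFun (Fin n) ℝ).toBasis (EuclideanSpace.basisFun (Fin n) ℝ).toBasis
    (Matrix.diagonal fun j => s ^ F.w j)

theorem dilLin_apply (s : ℝ) (v : Vec n) : dilLin F s v = F.dil s v := by
  ext j
  simp [dilLin, Matrix.toLin_apply, FilteredManifold.dil, Matrix.mulVec_diagonal, Pi.single_apply]

theorem det_dilLin (s : ℝ) : LinearMap.det (dilLin F s) = s ^ F.homDim := by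
  rw [dilLin, LinearMap.det_toLin, Matrix.det_diagonal, FilteredManifold.homDim,
    Finset.prod_pow_eq_pow_sum]

/-- The Jacobian of `δ_s` is `s ^ F.homDim`: this is what singles out the order `-F.homDim`, for
which the cocycle identity carries no scaling factor. -/
theorem integral_comp_dil (s : {s : ℝ // 0 < s}) (f : Vec n → ℂ) :
    ((s : ℝ) : ℂ) ^ F.homDim * ∫ v, f (F.dil s v) = ∫ v, f v := by
  have hs : (s : ℝ) ^ F.homDim ≠ 0 := pow_ne_zero _ s.2.ne'
  have hd : LinearMap.det (dilLin F s) ≠ 0 := by rwa [det_dilLin]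
  have h1 := Measure.map_linearMap_addHaar_eq_smul_addHaar (volume : Measure (Vec n)) hd
  have h2 : (dilLin F (s : ℝ) : Vec n → Vec n) = dilHomeomorph F s := by
    funext v
    exact dilLin_apply _ _
  have h3 := (dilHomeomorph F s).measurableEmbedding.integral_map (μ := volume) f
  rw [← h2, h1, integral_smul_measure, det_dilLin, h2] at h3
  have h4 : 0 < ((s : ℝ) ^ F.homDim)⁻¹ := inv_pos.mpr (pow_pos s.2 _)
  rw [abs_of_pos h4, ENNReal.toReal_ofReal h4.le] at h3
  change _ = ∫ v, f (F.dil s v) at h3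
  rw [← h3, Complex.real_smul, ← mul_assoc]
  have hs' : ((s : ℝ) : ℂ) ^ F.homDim ≠ 0 := by exact_mod_cast hs
  push_cast
  rw [mul_inv_cancel₀ hs', one_mul]

/-- The complex conjugate of a smooth function. -/
def conjFun (f : smoothFun F) : smoothFun F :=
  ⟨fun γ => conj (f.1 γ), by
    have hf : IsSmooth f.1 := f.2
    have hc : ContMDiff 𝓘(ℝ, ℂ) 𝓘(ℝ, ℂ) ∞ (fun z : ℂ => conj z) :=
      Complex.conjCLE.contDiff.contMDiff
    refine ⟨hc.comp_contMDiffOn hf.pair, fun c => ?_⟩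
    refine (hc.comp_contMDiffOn (hf.chart c)).congr fun p hp => ?_
    rw [Function.comp_apply, c.read_of_mem _ hp, c.read_of_mem _ hp]⟩

theorem zoomPullback_apply (s : {s : ℝ // 0 < s}) (f : smoothFun F) (γ : TangentGroupoid F) :
    (zoomPullback s f).1 γ = f.1 (γ.zoom s) := rfl

theorem zoomPullback_zoomPullback (s t : {s : ℝ // 0 < s}) (f : smoothFun F) :
    zoomPullback t (zoomPullback s f) = zoomPullback (s * t) f := by
  apply Subtype.ext
  funext γ
  simp only [zoomPullback_apply]
  refine congrArg f.1 ?_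
  cases γ with
  | pair y x r hr =>
    simp only [TangentGroupoid.zoom, TangentGroupoid.pair.injEq, true_and, Positive.val_mul]
    rw [mul_inv, mul_assoc]
  | osc x ξ =>
    have : F.oscDil s (F.oscDil t ξ) = F.oscDil (s * t : ℝ) ξ := by
      funext i
      simp only [FilteredManifold.oscDil, mul_pow, smul_smul]
    simp only [TangentGroupoid.zoom, Positive.val_mul, this]

theorem integral_conj_mul_self {V : Type*} [TopologicalSpace V] [MeasurableSpace V]
    {μ : Measure V} (φ : V → ℂ) :
    ∫ v, conj (φ v) * φ v ∂μ = ((∫ v, Complex.normSq (φ v) ∂μ : ℝ) : ℂ) := by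
  rw [← integral_complex_ofReal]
  exact integral_congr_ae (Eventually.of_forall fun v => Complex.normSq_eq_conj_mul_self.symm)

theorem integral_normSq_pos {φ : Vec n → ℂ} (hφ : Continuous φ) (hs : HasCompactSupport φ)
    {v : Vec n} (hv : φ v ≠ 0) : 0 < ∫ v, Complex.normSq (φ v) :=
  (Complex.continuous_normSq.comp hφ).integral_pos_of_hasCompactSupport_nonneg_nonzero (x := v)
    (hs.comp_left (g := Complex.normSq) (map_zero _)) (fun _ => Complex.normSq_nonneg _)
    (fun h => hv (Complex.normSq_eq_zero.mp h))

/-- A continuous function on the fibre that annihilates its own conjugate vanishes. -/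
theorem eq_zero_of_integral_conj_mul_self {φ : Vec n → ℂ} (hφ : Continuous φ)
    (hs : HasCompactSupport φ) (h : ∫ v, conj (φ v) * φ v = 0) (v : Vec n) : φ v = 0 := by
  by_contra hv
  rw [integral_conj_mul_self] at h
  exact (integral_normSq_pos hφ hs hv).ne' (by exact_mod_cast h)

variable [MeasurableSpace M]

omit [IsManifold 𝓘(ℝ, Vec n) ∞ M] in
theorem SmoothMeasure.onBasis_ne_zero (μ : SmoothMeasure n M) {x : M}
    {b : Fin n → TangentSpace 𝓘(ℝ, Vec n) x} (hb : LinearIndependent ℝ b) :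
    μ.onBasis x b ≠ 0 := by
  refine mul_ne_zero (μ.pos x _ (mem_chart_target _ x)).ne' (abs_ne_zero.mpr ?_)
  have h1 : LinearIndependent ℝ fun j => (show Vec n from b j) := hb
  have h2 := h1.map' (WithLp.linearEquiv 2 ℝ (Fin n → ℝ)).toLinearMap (LinearEquiv.ker _)
  have h3 := (Matrix.linearIndependent_cols_iff_isUnit
    (A := Matrix.of fun i j => (show Vec n from b j) i)).mp h2
  exact ((Matrix.isUnit_iff_isUnit_det _).mp h3).ne_zero

theorem IsCocycle.apply_osc {μ : SmoothMeasure n M} {k : RFiberedDistribution F}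
    {s : {s : ℝ // 0 < s}} {g : smoothFun F} (hg : IsCocycle μ k (-(F.homDim : ℤ)) s g) {x : M}
    {b : Fin n → TangentSpace 𝓘(ℝ, Vec n) x} (hb : F.IsAdapted x b) (f : smoothFun F) :
    ((s : ℝ) : ℂ) ^ F.homDim * (k.toLinearMap (zoomPullback s f)).1 (x, 0) -
      (k.toLinearMap f).1 (x, 0) =
    (∫ v, f.1 (oscFibre hb v) * g.1 (oscFibre hb v)) * (μ.onBasis x b : ℝ) := by
  have := hg.density.osc f x b hb
  rw [integral_mul_const] at this
  simpa [RFiberedDistribution.pushforward, oscFibre] using this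

theorem integrable_mul_of_hasCompactSupport {φ ψ : Vec n → ℂ} (hφ : Continuous φ)
    (hψ : Continuous ψ) (hs : HasCompactSupport ψ) : Integrable fun v => φ v * ψ v :=
  (hφ.mul hψ).integrable_of_hasCompactSupport hs.mul_left

/-- The cocycle identity on the fibre over `(x, 0)`. -/
theorem IsCocycle.cocycle_identity [T2Space M] {μ : SmoothMeasure n M}
    {k : RFiberedDistribution F} {s t : {s : ℝ // 0 < s}} {gs gt gst : smoothFun F}
    (hs : IsCocycle μ k (-(F.homDim : ℤ)) s gs) (ht : IsCocycle μ k (-(F.homDim : ℤ)) t gt)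
    (hst : IsCocycle μ k (-(F.homDim : ℤ)) (s * t) gst) (c : ExpChart F) {x : M} (hx : x ∈ c.U)
    (v : Vec n) :
    gst.1 (oscFibre (c.adapted x hx) v) = gt.1 (oscFibre (c.adapted x hx) (F.dil (s : ℝ)⁻¹ v)) +
      gs.1 (oscFibre (c.adapted x hx) v) := by
  set hb := c.adapted x hx
  have hD : ((μ.onBasis x (fun j => c.X j x) : ℝ) : ℂ) ≠ 0 := by
    exact_mod_cast μ.onBasis_ne_zero hb.linearIndependent
  have hcs := c.hasCompactSupport_comp_oscFibre hx hs.proper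
  have hct := (c.hasCompactSupport_comp_oscFibre hx ht.proper).comp_homeomorph
    (dilHomeomorph F s⁻¹)
  have hcst := c.hasCompactSupport_comp_oscFibre hx hst.proper
  have hks := c.continuous_comp_oscFibre hx gs
  have hkt : Continuous fun v => gt.1 (oscFibre hb (F.dil (s : ℝ)⁻¹ v)) :=
    (c.continuous_comp_oscFibre hx gt).comp (continuous_dil _)
  have hkst := c.continuous_comp_oscFibre hx gst
  replace hct : HasCompactSupport fun v => gt.1 (oscFibre hb (F.dil (s : ℝ)⁻¹ v)) := hct
  -- Weak form of the identity: telescoping, with the cocycle at `t` applied to `f ∘ α_s`, followed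
  -- by the change of variables `v ↦ δ_s v`.
  have key : ∀ f : smoothFun F, ∫ v, f.1 (oscFibre hb v) * gst.1 (oscFibre hb v) =
      (∫ v, f.1 (oscFibre hb v) * gt.1 (oscFibre hb (F.dil (s : ℝ)⁻¹ v))) +
      ∫ v, f.1 (oscFibre hb v) * gs.1 (oscFibre hb v) := by
    intro f
    have h1 := hst.apply_osc hb f
    have h2 := ht.apply_osc hb (zoomPullback s f)
    have h3 := hs.apply_osc hb f
    have h4 := integral_comp_dil (F := F) s
      fun v => f.1 (oscFibre hb v) * gt.1 (oscFibre hb (F.dil (s : ℝ)⁻¹ v))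
    simp only [dil_dil, inv_mul_cancel₀ s.2.ne', dil_one] at h4
    rw [zoomPullback_zoomPullback] at h2
    simp only [zoomPullback_apply, zoom_oscFibre] at h2
    rw [← h4]
    apply mul_right_cancel₀ hD
    rw [← h1, add_mul, mul_assoc, ← h2, ← h3, Positive.val_mul]
    push_cast
    ring
  -- The defect is itself a smooth function on the groupoid, so its conjugate is an admissible test
  -- function and the weak identity forces `∫ |g|² = 0` on the fibre.
  set g : smoothFun F := gst - zoomPullback s⁻¹ gt - gs with hg
  have hgv : ∀ v, g.1 (oscFibre hb v) = gst.1 (oscFibre hb v) -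
      gt.1 (oscFibre hb (F.dil (s : ℝ)⁻¹ v)) - gs.1 (oscFibre hb v) := by
    intro v
    rw [show (s : ℝ)⁻¹ = ((s⁻¹ : {s : ℝ // 0 < s}) : ℝ) from rfl, ← zoom_oscFibre, ← zoomPullback_apply]
    rfl
  have hv := eq_zero_of_integral_conj_mul_self (c.continuous_comp_oscFibre hx g) ?_ ?_ v
  · rw [hgv] at hv
    linear_combination hv
  · simp only [hgv]
    exact (hcst.sub hct).sub hcs
  · have hk := key (conjFun g)
    have hkg := c.continuous_comp_oscFibre hx (conjFun g)
    change ∫ v, (conjFun g).1 (oscFibre hb v) * g.1 (oscFibre hb v) = 0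
    simp only [hgv, mul_sub]
    rw [integral_sub, integral_sub, hk]
    · ring
    · exact integrable_mul_of_hasCompactSupport hkg hkst hcst
    · exact integrable_mul_of_hasCompactSupport hkg hkt hct
    · exact (integrable_mul_of_hasCompactSupport hkg hkst hcst).sub
        (integrable_mul_of_hasCompactSupport hkg hkt hct)
    · exact integrable_mul_of_hasCompactSupport hkg hks hcs

theorem IsCocycle.map_mul [T2Space M] {μ : SmoothMeasure n M}
    {k : RFiberedDistribution F} {s t : {s : ℝ // 0 < s}} {gs gt gst : smoothFun F}
    (hs : IsCocycle μ k (-(F.homDim : ℤ)) s gs) (ht : IsCocycle μ k (-(F.homDim : ℤ)) t gt)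
    (hst : IsCocycle μ k (-(F.homDim : ℤ)) (s * t) gst) (x : M) :
    gst.1 (.osc x 0) = gs.1 (.osc x 0) + gt.1 (.osc x 0) := by
  obtain ⟨c, hx⟩ := exists_expChart F x
  have h := hs.cocycle_identity ht hst c hx 0
  have h0 : F.dil (s : ℝ)⁻¹ 0 = 0 := by rw [← dilLin_apply, map_zero]
  rw [h0, oscFibre_zero] at h
  rw [h, add_comm]

end FibreIntegral

/-! ### Smooth families as continuous curves in the `C^∞` topology. -/

section SmoothFamilies

open Set Filter

/-- The partial derivatives of all orders of a smooth function are jointly continuous. -/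
theorem continuousOn_iteratedFDeriv_prodMk {E G : Type*} [NormedAddCommGroup E] [NormedSpace ℝ E]
    [NormedAddCommGroup G] [NormedSpace ℝ G] {f : ℝ × E → G} {O : Set (ℝ × E)} (hO : IsOpen O)
    (hf : ContDiffOn ℝ ∞ f O) (m : ℕ) :
    ContinuousOn (fun p : ℝ × E => iteratedFDeriv ℝ m (fun u => f (p.1, u)) p.2) O := by
  have h1 : ContinuousOn (fun p => (iteratedFDeriv ℝ m f p).compContinuousLinearMap
      fun _ => ContinuousLinearMap.inr ℝ ℝ E) O :=
    (ContinuousMultilinearMap.compContinuousLinearMapL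
      (fun _ : Fin m => ContinuousLinearMap.inr ℝ ℝ E)).continuous.comp_continuousOn
      ((hf.continuousOn_iteratedFDerivWithin (by exact_mod_cast le_top) hO.uniqueDiffOn).congr
        fun p hp => (iteratedFDerivWithin_of_isOpen m hO hp).symm)
  refine h1.congr fun p hp => ?_
  -- Freezing the first variable is the linear inclusion `inr` followed by a translation, so partial
  -- derivatives are full derivatives restricted along `inr`.
  set T : Set (ℝ × E) := (fun q => (p.1, 0) + q) ⁻¹' O with hT
  have hTo : IsOpen T := hO.preimage (by fun_prop)
  set g : ℝ × E → G := fun q => f ((p.1, 0) + q) with hg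
  have hgT : ContDiffOn ℝ ∞ g T := hf.comp (by fun_prop) fun q hq => hq
  have hpT : (ContinuousLinearMap.inr ℝ ℝ E) p.2 ∈ T := by
    simpa [hT] using hp
  have hgi : (fun u => f (p.1, u)) = g ∘ (ContinuousLinearMap.inr ℝ ℝ E) := by
    funext u
    simp [hg]
  have hpre : IsOpen ((ContinuousLinearMap.inr ℝ ℝ E) ⁻¹' T) :=
    hTo.preimage (ContinuousLinearMap.inr ℝ ℝ E).continuous
  have h2 := (ContinuousLinearMap.inr ℝ ℝ E).iteratedFDerivWithin_comp_right hgT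
    hTo.uniqueDiffOn hpre.uniqueDiffOn hpT (i := m) (by exact_mod_cast le_top)
  rw [iteratedFDerivWithin_of_isOpen m hpre hpT, iteratedFDerivWithin_of_isOpen m hTo hpT] at h2
  change iteratedFDeriv ℝ m (fun u => f (p.1, u)) p.2 = _
  rw [hgi, h2]
  congr 1
  rw [hg, iteratedFDeriv_comp_add_left]
  simp

/-- A smooth family of functions is continuous for the `C^∞` topology. -/
theorem continuous_cInfTopology {E' H' Z : Type*} [NormedAddCommGroup E'] [NormedSpace ℝ E']
    [TopologicalSpace H'] {I : ModelWithCorners ℝ E' H'} [TopologicalSpace Z] [ChartedSpace H' Z]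
    [I.Boundaryless] [IsManifold I ∞ Z] {O : Set Z} (hO : IsOpen O) {G : ℝ × Z → ℂ}
    (hG : ContMDiffOn (𝓘(ℝ, ℝ).prod I) 𝓘(ℝ, ℂ) ∞ G (Ioi 0 ×ˢ O)) :
    Continuous[inferInstance, cInfTopology I O] fun (s : {s : ℝ // 0 < s}) (z : Z) => G (s, z) := by
  refine continuous_iInf_rng.mpr fun z => continuous_iInf_rng.mpr fun m =>
    continuous_induced_rng.mpr ?_
  set e := extChartAt I z with he
  have hAo : IsOpen (e.target ∩ e.symm ⁻¹' O) :=
    (continuousOn_extChartAt_symm z).isOpen_inter_preimage (isOpen_extChartAt_target z) hO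
  have hsm : ContDiffOn ℝ ∞ (fun p : ℝ × E' => G (p.1, e.symm p.2))
      (Ioi 0 ×ˢ (e.target ∩ e.symm ⁻¹' O)) := by
    have h1 : ContMDiffOn 𝓘(ℝ, ℝ × E') (𝓘(ℝ, ℝ).prod I) ∞ (fun p : ℝ × E' => (p.1, e.symm p.2))
        (Ioi 0 ×ˢ (e.target ∩ e.symm ⁻¹' O)) := by
      refine ContMDiffOn.prodMk contDiff_fst.contMDiff.contMDiffOn ?_
      exact (contMDiffOn_extChartAt_symm z).comp contDiff_snd.contMDiff.contMDiffOn
        fun p hp => hp.2.1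
    exact contMDiffOn_iff_contDiffOn.mp (hG.comp h1 fun p hp => ⟨hp.1, hp.2.2⟩)
  have hcont := continuousOn_iteratedFDeriv_prodMk (isOpen_Ioi.prod hAo) hsm m
  rw [continuous_iff_continuousAt]
  intro s₀
  refine UniformOnFun.tendsto_iff_tendstoUniformlyOn.mpr fun K hK => ?_
  intro u hu
  -- Joint continuity and compactness of `K` give closeness uniformly on `K` for parameters near
  -- `s₀`.
  obtain ⟨v, hv, hvK⟩ := hK.1.mem_uniformity_of_prod
    (f := fun (s : ℝ) (w : E') => iteratedFDeriv ℝ m (fun w => G (s, e.symm w)) w) (s := Ioi 0)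
    (hcont.mono (prod_mono_right hK.2)) (mem_Ioi.mpr s₀.2) (symm_le_uniformity hu)
  rw [isOpen_Ioi.nhdsWithin_eq (mem_Ioi.mpr s₀.2)] at hv
  filter_upwards [continuous_subtype_val.continuousAt.preimage_mem_nhds hv] with s hs w hw
  exact hvK s hs w hw

end SmoothFamilies

/-! ### Continuity in `s` of `k (f ∘ α_s)`. -/

section ZoomContinuity

open Set Filter

variable {n : ℕ} {M : Type*} [TopologicalSpace M] [ChartedSpace (Vec n) M]
  [IsManifold 𝓘(ℝ, Vec n) ∞ M] {F : FilteredManifold n M}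

theorem ExpChart.isOpen_dom (c : ExpChart F) : IsOpen c.dom := by
  refine c.isOpen_Ω.preimage (continuous_fst.prodMk (Continuous.neg ?_))
  unfold FilteredManifold.dil
  fun_prop

theorem contDiff_dil : ContDiff ℝ ∞ (fun p : ℝ × Vec n => F.dil p.1 p.2) := by
  rw [contDiff_euclidean]
  intro j
  simp only [FilteredManifold.dil]
  fun_prop

theorem oscDil_zero (s : ℝ) (x : M) : F.oscDil s (0 : F.Osc x) = 0 := by
  funext i
  simp [FilteredManifold.oscDil]

/-- The converse inclusion makes the zoom compatible with the extension by zero in `ExpChart.read`,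
so `read_zoomPullback` holds at every point. -/
theorem ExpChart.zoom_mem_dom_iff (c : ExpChart F) (s : {s : ℝ // 0 < s})
    {p : M × (Vec n × ℝ)} : (p.1, F.dil s p.2.1, (s : ℝ)⁻¹ * p.2.2) ∈ c.dom ↔ p ∈ c.dom := by
  have h : (s : ℝ)⁻¹ * p.2.2 * s = p.2.2 := by
    have := s.2.ne'
    field_simp
  simp [ExpChart.dom, dil_dil, h]

theorem ExpChart.read_zoomPullback (c : ExpChart F) (s : {s : ℝ // 0 < s}) (f : smoothFun F)
    (p : M × (Vec n × ℝ)) :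
    c.read (zoomPullback s f).1 p = c.read f.1 (p.1, F.dil s p.2.1, (s : ℝ)⁻¹ * p.2.2) := by
  by_cases hp : p ∈ c.dom
  · rw [c.read_of_mem _ hp, c.read_of_mem _ (c.zoom_mem_dom s hp), zoomPullback_apply,
      c.zoom_param]
  · rw [ExpChart.read, ExpChart.read, dif_neg hp, dif_neg (mt (c.zoom_mem_dom_iff s).mp hp)]

theorem continuous_zoomPullback (f : smoothFun F) :
    Continuous[inferInstance, smoothFunTopology F] fun s => zoomPullback s f := by
  have hf : IsSmooth f.1 := f.2
  have hinv : ContDiffOn ℝ ∞ (fun p : ℝ × ℝ => p.1⁻¹ * p.2) (Ioi 0 ×ˢ univ) :=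
    (contDiffOn_fst.inv fun p hp => ne_of_gt hp.1).mul contDiffOn_snd
  refine continuous_inf_rng.mpr ⟨continuous_induced_rng.mpr ?_, continuous_iInf_rng.mpr fun c =>
    continuous_induced_rng.mpr ?_⟩
  · have hO : IsOpen {p : M × (M × ℝ) | p.2.2 ≠ 0} :=
      isOpen_ne_fun (by fun_prop) continuous_const
    have h : ContMDiffOn (𝓘(ℝ, ℝ).prod (𝓘(ℝ, Vec n).prod (𝓘(ℝ, Vec n).prod 𝓘(ℝ, ℝ))))
        (𝓘(ℝ, Vec n).prod (𝓘(ℝ, Vec n).prod 𝓘(ℝ, ℝ))) ∞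
        (fun q : ℝ × (M × (M × ℝ)) => (q.2.1, q.2.2.1, q.1⁻¹ * q.2.2.2))
        (Ioi 0 ×ˢ {p : M × (M × ℝ) | p.2.2 ≠ 0}) := by
      refine ContMDiffOn.prodMk (contMDiff_fst.comp contMDiff_snd).contMDiffOn
        (ContMDiffOn.prodMk (contMDiff_fst.comp (contMDiff_snd.comp contMDiff_snd)).contMDiffOn ?_)
      exact hinv.contMDiffOn.comp (contMDiff_fst.prodMk_space
        (contMDiff_snd.comp (contMDiff_snd.comp contMDiff_snd))).contMDiffOn
        fun q hq => ⟨hq.1, mem_univ _⟩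
    have h2 := continuous_cInfTopology (I := 𝓘(ℝ, Vec n).prod (𝓘(ℝ, Vec n).prod 𝓘(ℝ, ℝ))) hO
      (hf.pair.comp h fun q hq => mul_ne_zero (inv_ne_zero (ne_of_gt hq.1)) hq.2)
    convert h2 using 1
    funext s p
    change f.1 ((TangentGroupoid.incl F p).zoom s) =
      f.1 (TangentGroupoid.incl F (p.1, p.2.1, (s : ℝ)⁻¹ * p.2.2))
    refine congrArg f.1 ?_
    -- The dummy value of `incl` at `t = 0` is a unit, which the zoom fixes, so the equality holds
    -- there too.
    by_cases hp : p.2.2 = 0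
    · simp [TangentGroupoid.incl, hp, TangentGroupoid.zoom, oscDil_zero]
    · simp [TangentGroupoid.incl, hp, s.2.ne', TangentGroupoid.zoom]
  · have h : ContMDiffOn (𝓘(ℝ, ℝ).prod (𝓘(ℝ, Vec n).prod (𝓘(ℝ, Vec n).prod 𝓘(ℝ, ℝ))))
        (𝓘(ℝ, Vec n).prod (𝓘(ℝ, Vec n).prod 𝓘(ℝ, ℝ))) ∞
        (fun q : ℝ × (M × (Vec n × ℝ)) => (q.2.1, F.dil q.1 q.2.2.1, q.1⁻¹ * q.2.2.2))
        (Ioi 0 ×ˢ c.dom) := by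
      refine ContMDiffOn.prodMk (contMDiff_fst.comp contMDiff_snd).contMDiffOn
        (ContMDiffOn.prodMk ?_ ?_)
      · exact (contDiff_dil.contMDiff.comp (contMDiff_fst.prodMk_space
          (contMDiff_fst.comp (contMDiff_snd.comp contMDiff_snd)))).contMDiffOn
      · exact hinv.contMDiffOn.comp (contMDiff_fst.prodMk_space
          (contMDiff_snd.comp (contMDiff_snd.comp contMDiff_snd))).contMDiffOn
          fun q hq => ⟨hq.1, mem_univ _⟩
    have h2 := continuous_cInfTopology (I := 𝓘(ℝ, Vec n).prod (𝓘(ℝ, Vec n).prod 𝓘(ℝ, ℝ)))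
      c.isOpen_dom ((hf.chart c).comp h fun q hq => c.zoom_mem_dom ⟨q.1, hq.1⟩ hq.2)
    convert h2 using 1
    funext s p
    exact c.read_zoomPullback s f p

omit [IsManifold 𝓘(ℝ, Vec n) ∞ M] in
/-- Evaluation at a point is continuous on `C^∞(M × ℝ)`. -/
theorem continuous_eval_baseFun (p : M × ℝ) :
    Continuous[baseFunTopology n M, inferInstance] fun f : baseFun n M => f.1 p := by
  set e := extChartAt (𝓘(ℝ, Vec n).prod 𝓘(ℝ, ℝ)) p with he
  set 𝔖 : Set (Set (Vec n × ℝ)) := {K | IsCompact K ∧ K ⊆ e.target ∩ e.symm ⁻¹' univ} with h𝔖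
  -- Evaluation at `p` is controlled by one term of the infimum: the chart at `p`, order `0` and the
  -- compact set `{e p}`.
  have hmem : {e p} ∈ 𝔖 := ⟨isCompact_singleton,
    singleton_subset_iff.mpr ⟨mem_extChartAt_target p, mem_univ _⟩⟩
  let τ : TopologicalSpace (baseFun n M) := TopologicalSpace.induced
    (fun f => UniformOnFun.ofFun 𝔖 (iteratedFDeriv ℝ 0 (f.1 ∘ e.symm))) inferInstance
  have hle : baseFunTopology n M ≤ τ := by
    have h1 := induced_mono (g := (Subtype.val : baseFun n M → (M × ℝ → ℂ)))
      ((iInf_le _ p).trans (iInf_le _ 0) :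
        cInfTopology (𝓘(ℝ, Vec n).prod 𝓘(ℝ, ℝ)) (univ : Set (M × ℝ)) ≤ _)
    rwa [induced_compose] at h1
  refine continuous_le_dom hle ?_
  have h2 : Continuous[τ, inferInstance] fun f : baseFun n M =>
      UniformOnFun.ofFun 𝔖 (iteratedFDeriv ℝ 0 (f.1 ∘ e.symm)) := continuous_induced_dom
  have h3 := (UniformOnFun.uniformContinuous_eval_of_mem (𝔖 := 𝔖)
    (ContinuousMultilinearMap (R := ℝ) (fun _ : Fin 0 => Vec n × ℝ) ℂ) (mem_singleton (e p))
    hmem).continuous.comp h2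
  have h4 := (ContinuousMultilinearMap.apply ℝ (fun _ : Fin 0 => Vec n × ℝ) ℂ
    (fun _ => 0)).continuous.comp h3
  refine (congrArg (fun g => Continuous[τ, inferInstance] g) ?_).mpr h4
  funext f
  change f.1 p = f.1 (e.symm (e p))
  rw [he, extChartAt_to_inv]

theorem RFiberedDistribution.continuous_apply_zoomPullback (k : RFiberedDistribution F)
    (f : smoothFun F) (p : M × ℝ) :
    Continuous fun s => (k.toLinearMap (zoomPullback s f)).1 p :=
  @Continuous.comp _ _ _ _ (baseFunTopology n M) _ _ _ (continuous_eval_baseFun p)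
    (@Continuous.comp _ _ _ _ (smoothFunTopology F) (baseFunTopology n M) _ _ k.continuous
      (continuous_zoomPullback f))

end ZoomContinuity

/-! ### Measurability of the cocycle at a unit. -/

section CocycleMeasurable

open Set Filter
open scoped ComplexConjugate

variable {n : ℕ} {M : Type*} [TopologicalSpace M] [ChartedSpace (Vec n) M]
  [IsManifold 𝓘(ℝ, Vec n) ∞ M] {F : FilteredManifold n M}

/-- As `δ_{1/(j+1)} v → 0`, dominated convergence with a bound of `ψ` applies. After a change of
variables this says that rescaled zooms of `φ` tend to a multiple of the Dirac mass at the unit. -/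
theorem tendsto_integral_mul_comp_dil {φ ψ : Vec n → ℂ} (hφ : Continuous φ)
    (hφs : HasCompactSupport φ) (hψ : Continuous ψ) (hψs : HasCompactSupport ψ) :
    Tendsto (fun j : ℕ => ∫ v, φ v * ψ (F.dil ((j : ℝ) + 1)⁻¹ v)) atTop
      (𝓝 (∫ v, φ v * ψ 0)) := by
  obtain ⟨C, hC⟩ := hψs.exists_bound_of_continuous hψ
  refine tendsto_integral_of_dominated_convergence (fun v => ‖φ v‖ * C) (fun j => ?_) ?_
    (fun j => Eventually.of_forall fun v => ?_) (Eventually.of_forall fun v => ?_)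
  · exact (hφ.mul (hψ.comp (continuous_dil _))).aestronglyMeasurable
  · exact (hφ.integrable_of_hasCompactSupport hφs).norm.mul_const C
  · rw [norm_mul]
    exact mul_le_mul_of_nonneg_left (hC _) (norm_nonneg _)
  · have h1 : Tendsto (fun j : ℕ => ((j : ℝ) + 1)⁻¹) atTop (𝓝 0) := by
      simpa [one_div] using tendsto_one_div_add_atTop_nhds_zero_nat (𝕜 := ℝ)
    have h2 : Continuous fun t : ℝ => F.dil t v :=
      contDiff_dil.continuous.comp (by fun_prop : Continuous fun t : ℝ => (t, v))
    have h3 := (h2.tendsto 0).comp h1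
    rw [dil_zero] at h3
    exact ((hψ.tendsto 0).comp h3).const_mul _

variable [MeasurableSpace M]

/-- If the cocycle does not vanish at a unit, its value there is a pointwise limit of continuous
functions of the parameter. -/
theorem measurable_cocycle_unit [T2Space M] {μ : SmoothMeasure n M} {k : RFiberedDistribution F}
    {g : {s : ℝ // 0 < s} → smoothFun F}
    (hg : ∀ s, IsCocycle μ k (-(F.homDim : ℤ)) s (g s)) (x : M) :
    Measurable fun s => (g s).1 (.osc x 0) := by
  -- Unless the function is identically zero, some `g s₀` is nonzero at the unit, and its squared
  -- modulus is a test function with compact support and positive integral `I` on the fibre.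
  by_cases h0 : ∀ s, (g s).1 (.osc x 0) = 0
  · simp only [h0]
    exact measurable_const
  push Not at h0
  obtain ⟨s₀, hs₀⟩ := h0
  obtain ⟨c, hx⟩ := exists_expChart F x
  set hb := c.adapted x hx
  set h := g s₀
  rw [← oscFibre_zero hb] at hs₀ ⊢
  have hc := fun f => c.continuous_comp_oscFibre hx f
  have hsupp := fun s => c.hasCompactSupport_comp_oscFibre hx (hg s).proper
  have hI := integral_normSq_pos (hc h) (hsupp s₀) hs₀
  have hD : ((μ.onBasis x (fun j => c.X j x) : ℝ) : ℂ) ≠ 0 := by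
    exact_mod_cast μ.onBasis_ne_zero hb.linearIndependent
  set D : ℂ := ((μ.onBasis x (fun j => c.X j x) : ℝ) : ℂ)
  set I : ℂ := ((∫ v, Complex.normSq (h.1 (oscFibre hb v)) : ℝ) : ℂ) with hIdef
  have hI' : I ≠ 0 := Complex.ofReal_ne_zero.mpr hI.ne'
  let t : ℕ → {s : ℝ // 0 < s} := fun j => ⟨(j : ℝ) + 1, by positivity⟩
  let f : ℕ → smoothFun F := fun j => zoomPullback (t j) (conjFun h * h)
  -- `T j s` pairs the cocycle at `s` with `|h|² ∘ α_{j+1}`. The power of `t j` undoes the Jacobian,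
  -- and `D * I` normalizes the total mass to one. It is continuous in `s` because it is expressed
  -- through `k`, not through `g s`.
  let T : ℕ → {s : ℝ // 0 < s} → ℂ := fun j s => (D * I)⁻¹ * (((t j : ℝ) : ℂ) ^ F.homDim *
    (((s : ℝ) : ℂ) ^ F.homDim * (k.toLinearMap (zoomPullback s (f j))).1 (x, 0) -
      (k.toLinearMap (f j)).1 (x, 0)))
  have hT : ∀ j s, T j s = (D * I)⁻¹ * D * ∫ v, (conj (h.1 (oscFibre hb v)) * h.1 (oscFibre hb v)) *
      (g s).1 (oscFibre hb (F.dil ((j : ℝ) + 1)⁻¹ v)) := by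
    intro j s
    have h4 := integral_comp_dil (F := F) (t j)
      fun v => (conj (h.1 (oscFibre hb v)) * h.1 (oscFibre hb v)) *
        (g s).1 (oscFibre hb (F.dil ((j : ℝ) + 1)⁻¹ v))
    have ht : ((j : ℝ) + 1)⁻¹ * (t j : ℝ) = 1 := inv_mul_cancel₀ (t j).2.ne'
    simp only [dil_dil, ht, dil_one] at h4
    have hf : ∀ v, (f j).1 (oscFibre hb v) = conj (h.1 (oscFibre hb (F.dil (t j) v))) *
        h.1 (oscFibre hb (F.dil (t j) v)) := fun v => by
      rw [← zoom_oscFibre]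
      rfl
    simp only [T]
    rw [(hg s).apply_osc hb, ← h4]
    simp only [hf]
    ring
  have hcont : ∀ j, Continuous (T j) := by
    intro j
    have h1 := k.continuous_apply_zoomPullback (f j) (x, 0)
    simp only [T]
    fun_prop
  refine measurable_of_tendsto_metrizable (fun j => (hcont j).measurable)
    (tendsto_pi_nhds.mpr fun s => ?_)
  have hlim := (tendsto_integral_mul_comp_dil (F := F)
    ((hc (conjFun h)).mul (hc h)) ((hsupp s₀).mul_left) (hc (g s)) (hsupp s)).const_mul
    ((D * I)⁻¹ * D)
  have hval : (D * I)⁻¹ * D * ∫ v, (conj (h.1 (oscFibre hb v)) * h.1 (oscFibre hb v)) *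
      (g s).1 (oscFibre hb 0) = (g s).1 (oscFibre hb 0) := by
    rw [integral_mul_const, integral_conj_mul_self, ← hIdef]
    field_simp
  simp only [hT]
  rw [← hval]
  exact hlim

end CocycleMeasurable

/-! ### From measurable homomorphisms to the logarithm. -/

/-- A measurable homomorphism from the positive reals to `ℂ` is a multiple of the logarithm. -/
theorem exists_eq_mul_log {c : {s : ℝ // 0 < s} → ℂ} (hc : Measurable c)
    (hmul : ∀ s t, c (s * t) = c s + c t) : ∃ r : ℂ, ∀ s, c s = r * (Real.log s : ℂ) := by
  let e : ℝ → {s : ℝ // 0 < s} := fun u => ⟨Real.exp u, Real.exp_pos u⟩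
  have he : Measurable e := Real.measurable_exp.subtype_mk
  let A : ℝ →+ ℂ := AddMonoidHom.mk' (fun u => c (e u)) fun u v => by
    rw [← hmul]
    exact congrArg c (Subtype.ext (Real.exp_add u v))
  -- Measurability of an additive map on `ℝ` implies continuity, hence real linearity, so `A` is
  -- determined by `A 1`.
  have hA : Continuous A := MeasureTheory.Measure.AddMonoidHom.continuous_of_measurable A (hc.comp he)
  refine ⟨A 1, fun s => ?_⟩
  have h1 := map_real_smul A hA (Real.log s) 1
  have h2 : A (Real.log s) = c s := congrArg c (Subtype.ext (Real.exp_log s.2))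
  rw [smul_eq_mul, mul_one, h2] at h1
  rw [h1, Complex.real_smul, mul_comm]

end FiltMfd

end

theorem lemma759 {n : ℕ} {M : Type*} [TopologicalSpace M] [T2Space M] [SecondCountableTopology M]
    [ChartedSpace (FiltMfd.Vec n) M] [IsManifold 𝓘(ℝ, FiltMfd.Vec n) ∞ M]
    [MeasurableSpace M] [BorelSpace M]
    (F : FiltMfd.FilteredManifold n M) (μ : FiltMfd.SmoothMeasure n M)
    (k : FiltMfd.RFiberedDistribution F)
    (hk : FiltMfd.IsEssHomogeneous μ k (-(F.homDim : ℤ))) (x : M) :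
    ∃ Φ : {s : ℝ // 0 < s} →* Multiplicative ℂ,
      (∀ (s : {s : ℝ // 0 < s}) (g : FiltMfd.smoothFun F),
        FiltMfd.IsCocycle μ k (-(F.homDim : ℤ)) s g →
          g.1 (.osc x 0) = Multiplicative.toAdd (Φ s)) ∧
      ∃ r : ℂ, (∀ s : {s : ℝ // 0 < s}, Multiplicative.toAdd (Φ s) = r * (Real.log s : ℂ)) ∧
        ∀ (s : {s : ℝ // 0 < s}) (g : FiltMfd.smoothFun F), s ≠ 1 →
          FiltMfd.IsCocycle μ k (-(F.homDim : ℤ)) s g →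
            (Real.log s : ℂ)⁻¹ * g.1 (.osc x 0) = r := by
  choose g hg using hk.exists_cocycle
  have hmul : ∀ (s t : {s : ℝ // 0 < s}) (g₁ g₂ g₃ : FiltMfd.smoothFun F),
      FiltMfd.IsCocycle μ k (-(F.homDim : ℤ)) s g₁ → FiltMfd.IsCocycle μ k (-(F.homDim : ℤ)) t g₂ →
      FiltMfd.IsCocycle μ k (-(F.homDim : ℤ)) (s * t) g₃ →
      g₃.1 (.osc x 0) = g₁.1 (.osc x 0) + g₂.1 (.osc x 0) :=
    fun s t g₁ g₂ g₃ h₁ h₂ h₃ => h₁.map_mul h₂ h₃ x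
  have hone : (g 1).1 (.osc x 0) = 0 := by
    have := hmul 1 1 _ _ (g 1) (hg 1) (hg 1) (by rw [mul_one]; exact hg 1)
    simpa using this
  -- Additivity for `s * 1 = s` shows that the value at the unit does not depend on which
  -- coefficient function represents the cocycle, so the choice of `g` is harmless.
  have huniq : ∀ (s : {s : ℝ // 0 < s}) (g' : FiltMfd.smoothFun F),
      FiltMfd.IsCocycle μ k (-(F.homDim : ℤ)) s g' → g'.1 (.osc x 0) = (g s).1 (.osc x 0) := by
    intro s g' hg'
    have := hmul s 1 _ _ g' (hg s) (hg 1) (by rw [mul_one]; exact hg')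
    rw [this, hone, add_zero]
  let Φ : {s : ℝ // 0 < s} →* Multiplicative ℂ :=
    { toFun := fun s => Multiplicative.ofAdd ((g s).1 (.osc x 0))
      map_one' := by rw [hone, ofAdd_zero]
      map_mul' := fun s t => by
        rw [hmul s t _ _ _ (hg s) (hg t) (hg (s * t)), ofAdd_add] }
  obtain ⟨r, hr⟩ := FiltMfd.exists_eq_mul_log (FiltMfd.measurable_cocycle_unit hg x)
    fun s t => hmul s t _ _ _ (hg s) (hg t) (hg (s * t))
  refine ⟨Φ, fun s g' hg' => huniq s g' hg', r, hr, fun s g' hs hg' => ?_⟩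
  rw [huniq s g' hg', hr s]
  have hlog : (Real.log s : ℂ) ≠ 0 := by
    have h1 : (s : ℝ) ≠ 1 := fun h => hs (Subtype.ext h)
    exact_mod_cast Real.log_ne_zero_of_pos_of_ne_one s.2 h1
  field_simp
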